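/- Let $M$ be a non-compact smooth manifold (without boundary). ``On a COCS'' means ``on the complement of some compact subset of $M$''. A \emph{cylindrical structure} on $M$ is a pair $(t,\partial_t)$, where $t:M\to\mathbb R$ is a proper (continuous) function, bounded below and smooth on a COCS, and $\partial_t$ is a smooth vector field on $M$ with $\partial_t(t)=1$ on a COCS. Given such a pair: * a smooth vector field $X$ on $M$ is \emph{constant} if $[X,\partial_t]=0$ on a COCS; $A(\mathfrak g)$ denotes the associative unital $\mathbb R$-algebra of differential operators on $C^\infty(M)$ generated by the constant vector fields; * a smooth function $f:M\to\mathbb R$ has \emph{polynomial growth} if for every $D\in A(\mathfrak g)$ there are an integer $N>0$ and a real $C>0$ such that $|D(f)|\le C\,t^N$ on a COCS; it is \emph{bounded with all its derivatives} if $D(f)$ is bounded on $M$ for every $D\in A(\mathfrak g)$; * a vector field $Z$ is \emph{weakly bounded} if $Z=\sum_i f_iX_i$ (a finite sum) with constant vector fields $X_i$ and bounded functions $f_i:M\to\mathbb R$, and \emph{strongly bounded} if such a representation exists with smooth $f_i$ that are bounded with all their derivatives; * for $r\ge 0$, the space $\Omega^r_{\mathrm{pol}}(M)$ of \emph{polynomially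 growing $r$-forms} consists of all smooth real $r$-forms $\omega$ on $M$ such that the function $\omega(X_1,\dots,X_r)$ has polynomial growth for all constant vector fields $X_1,\dots,X_r$. **Theorem.** Let $(t,\partial_t)$ be a cylindrical structure on $M$ and let $Y=\partial_t+Y_\perp$, where $Y_\perp$ is a smooth vector field that is perpendicular, i.e. $Y_\perp(t)=0$ on a COCS. Assume that $Y_\perp$ is strongly bounded and that for every constant vector field $X$ the field $t\,[X,Y_\perp]$ is weakly bounded (all with respect to $(t,\partial_t)$). Then $(t,Y)$ is also a cylindrical structure on $M$, and for every $r\ge 0$ the spaces $\Omega^r_{\mathrm{pol}}(M)$ defined by $(t,\partial_t)$ and by $(t,Y)$ coincide. -/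

import Mathlib

open scoped Manifold ContDiff

noncomputable section

namespace CylEnd

/-- The model space of an `n`-dimensional manifold without boundary. -/
abbrev Model (n : ℕ) : Type := EuclideanSpace ℝ (Fin n)

/-- The ring of smooth real-valued functions on `M`. -/
abbrev SmoothFun (n : ℕ) (M : Type*) [TopologicalSpace M] [ChartedSpace (Model n) M] : Type _ :=
  ContMDiffMap (𝓡 n) 𝓘(ℝ, ℝ) M ℝ ∞

/-- Smooth vector fields on `M`, i.e. smooth sections of the tangent bundle. -/
abbrev SmoothField (n : ℕ) (M : Type*) [TopologicalSpace M] [ChartedSpace (Model n) M]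
    [IsManifold (𝓡 n) ∞ M] : Type _ :=
  ContMDiffSection (𝓡 n) (Model n) ∞ (fun x : M => TangentSpace (𝓡 n) x)

section

variable {n : ℕ} {M : Type*} [TopologicalSpace M] [ChartedSpace (Model n) M]
  [IsManifold (𝓡 n) ∞ M]

/-- The derivative `X(f)` of a smooth function along a smooth vector field is smooth. -/
theorem contMDiff_fieldDeriv (X : SmoothField n M) (f : SmoothFun n M) :
    ContMDiff (𝓡 n) 𝓘(ℝ, ℝ) ∞ (fun x : M => mvfderiv (𝓡 n) f x (X x)) := by
  have h1 : ContMDiff (𝓡 n).tangent 𝓘(ℝ, ℝ).tangent ∞ (tangentMap (𝓡 n) 𝓘(ℝ, ℝ) f) :=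
    f.contMDiff.contMDiff_tangentMap (by simp)
  have h2 := h1.comp X.contMDiff
  intro x
  have h3 := Bundle.contMDiffAt_totalSpace.1 (h2 x)
  simpa using! h3.2

/-- A smooth vector field `X` as a first-order differential operator `f ↦ X(f)`. -/
def fieldDeriv (X : SmoothField n M) : Module.End ℝ (SmoothFun n M) where
  toFun f := ⟨fun x => mvfderiv (𝓡 n) f x (X x), contMDiff_fieldDeriv X f⟩
  map_add' f g := by
    ext x
    have hf := (f.contMDiff x).mdifferentiableAt (by simp)
    have hg := (g.contMDiff x).mdifferentiableAt (by simp)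
    have := mvfderiv_add hf hg
    change mvfderiv (𝓡 n) (⇑f + ⇑g) x (X x) = _
    rw [this]
    rfl
  map_smul' c f := by
    ext x
    have hf := (f.contMDiff x).mdifferentiableAt (by simp)
    have h : mvfderiv (𝓡 n) (c • ⇑f) x = c • mvfderiv (𝓡 n) f x := by
      ext v
      exact congrArg (fun L => L v) (const_smul_mfderiv hf c)
    change mvfderiv (𝓡 n) (c • ⇑f) x (X x) = _
    rw [h]
    rfl

/-- `(t, T)` is a cylindrical structure on `M`, where `T` plays the role of `∂_t`: the function `t`
is proper, bounded below and smooth off a compact set, and `T(t) = 1` off a compact set. -/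
structure IsCylindricalStructure (t : M → ℝ) (T : SmoothField n M) : Prop where
  smooth_near_infinity : ∃ K : Set M, IsCompact K ∧ ContMDiffOn (𝓡 n) 𝓘(ℝ, ℝ) ∞ t Kᶜ
  proper : IsProperMap t
  bounded_below : ∃ a : ℝ, ∀ x, t x ∈ Set.Ici a
  deriv_eq_one : ∃ K : Set M, IsCompact K ∧ ∀ x ∉ K, mvfderiv (𝓡 n) t x (T x) = 1

/-- `X` is a constant vector field for the cylindrical structure `(t, T)`: it commutes with `T`
off a compact set. (The function `t` does not enter.) -/
def IsConstantField (T X : SmoothField n M) : Prop :=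
  ∃ K : Set M, IsCompact K ∧ ∀ x ∉ K, VectorField.mlieBracket (𝓡 n) X T x = 0

/-- `X` is perpendicular: `X(t) = 0` off a compact set. -/
def IsPerpendicular (t : M → ℝ) (X : SmoothField n M) : Prop :=
  ∃ K : Set M, IsCompact K ∧ ∀ x ∉ K, mvfderiv (𝓡 n) t x (X x) = 0

/-- The associative algebra (with unit) of differential operators with constant coefficients,
generated by the constant vector fields. -/
def constOperators (T : SmoothField n M) : Subalgebra ℝ (Module.End ℝ (SmoothFun n M)) :=
  Algebra.adjoin ℝ {D | ∃ X : SmoothField n M, IsConstantField T X ∧ D = fieldDeriv X}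

/-- `f` is smooth, and for each differential operator `D` with constant coefficients there are
`N, C > 0` with `|D f| ≤ C t ^ N` off a compact set. -/
def HasPolynomialGrowth (t : M → ℝ) (T : SmoothField n M) (f : M → ℝ) : Prop :=
  ∃ hf : ContMDiff (𝓡 n) 𝓘(ℝ, ℝ) ∞ f, ∀ D ∈ constOperators T,
    ∃ (N : ℕ) (C : ℝ), 0 < N ∧ 0 < C ∧ ∃ K : Set M, IsCompact K ∧
      ∀ x ∉ K, |D (⟨f, hf⟩ : SmoothFun n M) x| ≤ C * t x ^ N

/-- `f` is bounded with all its derivatives. -/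
def IsBoundedWithDerivatives (T : SmoothField n M) (f : SmoothFun n M) : Prop :=
  ∀ D ∈ constOperators T, ∃ B : ℝ, ∀ x, |D f x| ≤ B

/-- A (not necessarily smooth) vector field is weakly bounded if it is a finite combination
of constant vector fields with bounded coefficients. -/
def IsWeaklyBounded (T : SmoothField n M) (Z : Π x : M, TangentSpace (𝓡 n) x) : Prop :=
  ∃ (m : ℕ) (f : Fin m → M → ℝ) (X : Fin m → SmoothField n M),
    (∀ i, IsConstantField T (X i)) ∧ (∀ i, ∃ B : ℝ, ∀ x, |f i x| ≤ B) ∧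
      ∀ x, Z x = ∑ i, f i x • X i x

/-- A vector field is strongly bounded if it is a finite combination of constant vector
fields whose coefficients are bounded with all their derivatives. -/
def IsStronglyBounded (T : SmoothField n M) (Z : Π x : M, TangentSpace (𝓡 n) x) : Prop :=
  ∃ (m : ℕ) (f : Fin m → SmoothFun n M) (X : Fin m → SmoothField n M),
    (∀ i, IsConstantField T (X i)) ∧ (∀ i, IsBoundedWithDerivatives T (f i)) ∧
      ∀ x, Z x = ∑ i, f i x • X i x

end

section

variable (n : ℕ) (M : Type*) [TopologicalSpace M] [ChartedSpace (Model n) M]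
  [IsManifold (𝓡 n) ∞ M]

/-- Smooth differential forms of degree `r` on `M`: families of alternating `r`-linear forms on the
tangent spaces which depend smoothly on the point when they are read in the local trivializations
of the tangent bundle. -/
structure SmoothForm (r : ℕ) where
  toFun : Π x : M, (TangentSpace (𝓡 n) x) [⋀^Fin r]→L[ℝ] ℝ
  smooth : ∀ x₀ : M, ContMDiffAt (𝓡 n) 𝓘(ℝ, (Model n) [⋀^Fin r]→L[ℝ] ℝ) ∞
    (fun x : M => (toFun x).compContinuousLinearMap
      ((trivializationAt (Model n) (TangentSpace (𝓡 n)) x₀).symmL ℝ x)) x₀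

end

section

variable {n : ℕ} {M : Type*} [TopologicalSpace M] [ChartedSpace (Model n) M]
  [IsManifold (𝓡 n) ∞ M]

/-- The space of polynomially growing `r`-forms for the cylindrical structure `(t, T)`: all smooth
`η` such that `η(X₁, …, X_r)` has polynomial growth for any constant fields `X₁, …, X_r`. -/
def polynomialForms (t : M → ℝ) (T : SmoothField n M) (r : ℕ) : Set (SmoothForm n M r) :=
  {η | ∀ X : Fin r → SmoothField n M, (∀ i, IsConstantField T (X i)) →
    HasPolynomialGrowth t T (fun x => η.toFun x (fun i => X i x))}

end

end CylEnd

end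

/-! Write Y = T + Y_⊥, with t replaced by a smooth function τ agreeing with it at infinity; all
identities below hold off a compact set. The flow of T moves points up the end at unit speed in τ.
Transporting vector fields and functions from a neighbourhood of a compact level of τ therefore
gives finitely many fields X_i with [X_i, T] = 0 and functions f_i with T(f_i) constant such that ∑
df_i ⊗ X_i = id (`exists_isInvariantFrame`). The same construction applies to Y.

Any field is Z = ∑ Z(f_i) X_i, and polynomially growing functions form a ring. It thus suffices that
Y-constant fields have polynomially growing coefficients in a T-frame, and T-constant fields in a
Y-frame (`PolyFun.transfer`, `PolyFun.eval_transfer`).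

These coefficients solve linear transport equations along Y. If [Z, Y] = 0, then Z(T f_i) = 0 gives
Y(Z f_i) = ∑_j X_j(Y_⊥ f_i) Z f_j. If Y(u) is constant, then Y(X_i u) = -∑_j ([X_i, Y_⊥] f_j) X_j u.
In both systems the matrix is O(1/τ): the hypothesis on t [X, Y_⊥] gives this, since T-invariant
functions are bounded. As for the ordinary differential inequality g' ≤ (A/τ) g, solutions grow at
most like a power of τ (`growth_of_transport`); a maximum principle proves this
(`transport_max_principle`).

Differentiating such a system along the frame gives a larger system of the same type, whose
inhomogeneity contains only derivatives already controlled. Induction on the order then bounds all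
derivatives (`IsPerturbation.polyOrder_of_transport`). Strong boundedness of Y_⊥ enters here, to
control the derivatives of the matrix.

The frame needs a smooth global flow. Smooth dependence on initial values comes from the implicit
function theorem in a space of curves, and completeness from the compact sublevel sets of τ. -/

noncomputable section

namespace CylEnd

open Set Filter Topology

universe u

/-! ### Composition operators on spaces of continuous curves -/

section Nemytskii

variable {K : Type*} [TopologicalSpace K] [CompactSpace K]

/-- Pointwise evaluation of a continuous family of continuous linear maps. -/
def pointwiseApply (K : Type*) [TopologicalSpace K] [CompactSpace K] (E F : Type*)
    [NormedAddCommGroup E] [NormedSpace ℝ E] [NormedAddCommGroup F] [NormedSpace ℝ F] :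
    C(K, E →L[ℝ] F) →L[ℝ] C(K, E) →L[ℝ] C(K, F) :=
  LinearMap.mkContinuous₂
    (LinearMap.mk₂ ℝ (fun (A : C(K, E →L[ℝ] F)) (h : C(K, E)) =>
        (⟨fun τ => A τ (h τ), by fun_prop⟩ : C(K, F)))
      (fun A B h => by ext; simp) (fun c A h => by ext; simp)
      (fun A h k => by ext; simp) (fun c A h => by ext; simp)) 1
    (fun A h => by
      rw [ContinuousMap.norm_le _ (by positivity)]
      intro τ
      rw [one_mul]
      exact ((A τ).le_opNorm (h τ)).trans
        (mul_le_mul (A.norm_coe_le_norm τ) (h.norm_coe_le_norm τ) (norm_nonneg _) (norm_nonneg A)))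

/-- The mean value inequality applies pointwise in τ; what has to be shown is that the modulus of
continuity of f' along γ is uniform in τ. -/
theorem hasFDerivAt_postcomp {E F : Type*}
    [NormedAddCommGroup E] [NormedSpace ℝ E] [NormedAddCommGroup F] [NormedSpace ℝ F]
    (f : C(E, F)) (f' : C(E, E →L[ℝ] F)) (hf : ∀ x, HasFDerivAt f (f' x) x) (γ : C(K, E)) :
    HasFDerivAt (fun γ : C(K, E) => f.comp γ) (pointwiseApply K E F (f'.comp γ)) γ := by
  rw [hasFDerivAt_iff_isLittleO, Asymptotics.isLittleO_iff]
  intro ε hε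
  have hc : ContinuousAt (fun γ : C(K, E) => f'.comp γ) γ :=
    (ContinuousMap.continuous_postcomp f').continuousAt
  obtain ⟨δ, hδ, H⟩ := (Metric.continuousAt_iff (α := C(K, E)) (β := C(K, E →L[ℝ] F))).1 hc ε hε
  filter_upwards [Metric.ball_mem_nhds γ hδ] with γ' hγ'
  rw [ContinuousMap.norm_le _ (by positivity)]
  intro τ
  have key : ∀ z ∈ Metric.ball (γ τ) δ, ‖f' z - f' (γ τ)‖ ≤ ε := by
    intro z hz
    -- A translate of γ by a constant passes through z at τ and stays δ-close to γ, so continuity of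
    -- γ ↦ f' ∘ γ in the sup norm bounds f' z - f' (γ τ).
    have h1 : dist (γ + ContinuousMap.const K (z - γ τ)) γ < δ := by
      rw [dist_eq_norm, add_sub_cancel_left]
      refine lt_of_le_of_lt ((ContinuousMap.norm_le _ (norm_nonneg _)).2 (fun _ => le_rfl)) ?_
      simpa [dist_eq_norm] using! hz
    have h2 := (ContinuousMap.dist_apply_le_dist
      (f := f'.comp (γ + ContinuousMap.const K (z - γ τ)))
      (g := f'.comp γ) τ).trans (H h1).le
    simpa [dist_eq_norm] using h2
  have hmem : γ' τ ∈ Metric.ball (γ τ) δ :=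
    lt_of_le_of_lt (ContinuousMap.dist_apply_le_dist (f := γ') (g := γ) τ) hγ'
  have h3 := (convex_ball (γ τ) δ).norm_image_sub_le_of_norm_hasFDerivWithin_le'
    (fun z _ => (hf z).hasFDerivWithinAt) key (Metric.mem_ball_self hδ) hmem
  refine h3.trans (mul_le_mul_of_nonneg_left ?_ hε.le)
  exact (γ' - γ).norm_coe_le_norm τ

/-- The derivative is again a composition operator, with f' in place of f, followed by a continuous
linear map. The induction changes the target F to E →L F, hence the common universe. -/
theorem contDiff_postcomp {E : Type u} [NormedAddCommGroup E] [NormedSpace ℝ E] (n : ℕ) :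
    ∀ {F : Type u} [NormedAddCommGroup F] [NormedSpace ℝ F] (f : C(E, F)),
      ContDiff ℝ n f → ContDiff ℝ n (fun γ : C(K, E) => f.comp γ) := by
  induction n with
  | zero =>
    intro F _ _ f _
    exact contDiff_zero.2 (ContinuousMap.continuous_postcomp f)
  | succ n ih =>
    intro F _ _ f hf
    have hf1 : ContDiff ℝ 1 f := hf.of_le (by norm_cast; omega)
    let f' : C(E, E →L[ℝ] F) := ⟨fderiv ℝ f, hf1.continuous_fderiv (by simp)⟩
    have hf' : ContDiff ℝ n f' := by
      have := (contDiff_succ_iff_fderiv (n := n)).1 (by exact_mod_cast hf)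
      exact this.2.2
    have hd : ∀ x, HasFDerivAt f (f' x) x := fun x =>
      (hf1.differentiable (by simp) x).hasFDerivAt
    have hA : ContDiff ℝ n (pointwiseApply K E F) :=
      ContinuousLinearMap.contDiff (E := C(K, E →L[ℝ] F)) (F := C(K, E) →L[ℝ] C(K, F)) _
    have := (contDiff_succ_iff_hasFDerivAt (𝕜 := ℝ) (n := n)
      (f := fun γ : C(K, E) => f.comp γ)).2
      ⟨fun γ => pointwiseApply K E F (f'.comp γ),
        hA.comp (ih f' hf'),
        fun γ => hasFDerivAt_postcomp f f' hd γ⟩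
    exact_mod_cast this

end Nemytskii

/-! ### Smooth local flows in Banach spaces, by the implicit function theorem -/

section LocalFlow

open unitInterval

variable {E : Type u} [NormedAddCommGroup E] [NormedSpace ℝ E] [CompleteSpace E]

/-- The primitive `τ ↦ ∫₀^τ γ` of a curve on the unit interval. -/
def primitive (E : Type u) [NormedAddCommGroup E] [NormedSpace ℝ E] [CompleteSpace E] :
    C(I, E) →L[ℝ] C(I, E) :=
  LinearMap.mkContinuous
    { toFun := fun γ => ⟨fun τ => ∫ r in (0 : ℝ)..τ, γ (projIcc 0 1 zero_le_one r), by
        have : Continuous fun r : ℝ => γ (projIcc 0 1 zero_le_one r) :=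
          γ.continuous.comp continuous_projIcc
        exact (intervalIntegral.continuous_primitive
          (fun a b => this.intervalIntegrable a b) 0).comp continuous_subtype_val⟩
      map_add' := fun γ η => by
        ext τ
        have h (γ : C(I, E)) : Continuous fun r : ℝ => γ (projIcc 0 1 zero_le_one r) :=
          γ.continuous.comp continuous_projIcc
        exact intervalIntegral.integral_add ((h γ).intervalIntegrable _ _)
          ((h η).intervalIntegrable _ _)
      map_smul' := fun c γ => by
        ext τ
        exact intervalIntegral.integral_smul c _ } 1
    (fun γ => by
      rw [ContinuousMap.norm_le _ (by positivity), one_mul]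
      intro τ
      refine (intervalIntegral.norm_integral_le_of_norm_le_const
        (fun r _ => γ.norm_coe_le_norm _)).trans ?_
      rw [sub_zero, abs_of_nonneg τ.2.1]
      exact mul_le_of_le_one_right (norm_nonneg _) τ.2.2)

theorem primitive_apply (γ : C(I, E)) (τ : I) :
    primitive E γ τ = ∫ r in (0 : ℝ)..τ, γ (projIcc 0 1 zero_le_one r) := rfl

/-- Slowing down a curve on the unit interval by the factor `τ`. -/
def slowDown (τ : I) (γ : C(I, E)) : C(I, E) := γ.comp ⟨fun r => τ * r, by fun_prop⟩

theorem slowDown_primitive (τ : I) (γ : C(I, E)) :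
    slowDown τ (primitive E γ) = (τ : ℝ) • primitive E (slowDown τ γ) := by
  ext q
  change primitive E γ (τ * q) = (τ : ℝ) • primitive E (slowDown τ γ) q
  rw [primitive_apply, primitive_apply]
  have h1 : ∫ r in (0 : ℝ)..q, slowDown τ γ (projIcc 0 1 zero_le_one r) =
      ∫ r in (0 : ℝ)..q, (fun q => γ (projIcc 0 1 zero_le_one q)) (τ * r) := by
    refine intervalIntegral.integral_congr (fun r hr => ?_)
    rw [uIcc_of_le q.2.1] at hr
    have hr1 : r ∈ Icc (0 : ℝ) 1 := ⟨hr.1, hr.2.trans q.2.2⟩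
    change γ (τ * projIcc 0 1 zero_le_one r) = γ (projIcc 0 1 zero_le_one (τ * r))
    congr 1
    ext
    rw [projIcc_of_mem _ hr1, projIcc_of_mem _ (unitInterval.mul_mem τ.2 hr1)]
    rfl
  rw [h1, intervalIntegral.smul_integral_comp_mul_left
    (fun q => γ (projIcc 0 1 zero_le_one q)) (τ : ℝ), mul_zero]
  rfl

/-- The constant curves, as a continuous linear map. -/
def constCurve (E : Type u) [NormedAddCommGroup E] [NormedSpace ℝ E] : E →L[ℝ] C(I, E) :=
  LinearMap.mkContinuous
    { toFun := fun x => ContinuousMap.const I x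
      map_add' := fun _ _ => rfl
      map_smul' := fun _ _ => rfl } 1
    (fun x => by
      rw [ContinuousMap.norm_le _ (by positivity), one_mul]
      exact fun _ => le_rfl)

/-- The integral equation `γ = x + s ∫ f ∘ γ`, as the vanishing of a map. -/
def flowEquation (f : C(E, E)) (p : (ℝ × E) × C(I, E)) : C(I, E) :=
  p.2 - constCurve E p.1.2 - p.1.1 • primitive E (f.comp p.2)

theorem contDiff_flowEquation (f : C(E, E)) (n : ℕ) (hf : ContDiff ℝ n f) :
    ContDiff ℝ n (flowEquation f) := by
  have h1 : ContDiff ℝ n (fun p : (ℝ × E) × C(I, E) => f.comp p.2) :=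
    (contDiff_postcomp n f hf).comp contDiff_snd
  have h2 : ContDiff ℝ n (fun p : (ℝ × E) × C(I, E) => primitive E (f.comp p.2)) :=
    (primitive E).contDiff.comp (g := primitive E) h1
  have h3 : ContDiff ℝ n (fun p : (ℝ × E) × C(I, E) => constCurve E p.1.2) := by fun_prop
  exact (contDiff_snd.sub h3).sub ((contDiff_fst.fst).smul h2)

/-- The time s is a factor in the equation, so that all curves live on the same interval. Slowing
down a solution for time s solves the equation for time τ s; with local uniqueness this shows that
the solutions for different s are pieces of one curve. -/
theorem flowEquation_slowDown (f : C(E, E)) (s : ℝ) (x : E) (γ : C(I, E)) (τ : I) :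
    flowEquation f ((τ * s, x), slowDown τ γ) = slowDown τ (flowEquation f ((s, x), γ)) := by
  have h := slowDown_primitive τ (f.comp γ)
  have h2 : slowDown τ (flowEquation f ((s, x), γ)) =
      slowDown τ γ - constCurve E x - s • slowDown τ (primitive E (f.comp γ)) := rfl
  rw [h2, h, smul_smul, mul_comm s]
  rfl

/-- At s = 0 the integral term disappears and the equation is γ ↦ γ - x₀, with identity derivative.
-/
theorem isInvertible_fderiv_flowEquation (f : C(E, E)) (hf : ContDiff ℝ 1 f) (x₀ : E) :
    (fderiv ℝ (flowEquation f) ((0, x₀), constCurve E x₀) ∘L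
      .inr ℝ (ℝ × E) C(I, E)).IsInvertible := by
  have hd : DifferentiableAt ℝ (flowEquation f) ((0, x₀), constCurve E x₀) :=
    (contDiff_flowEquation f 1 (by exact_mod_cast hf)).differentiable (by simp) _
  have h1 : HasFDerivAt (fun γ : C(I, E) => (((0 : ℝ), x₀), γ))
      (ContinuousLinearMap.inr ℝ (ℝ × E) C(I, E)) (constCurve E x₀) :=
    hasFDerivAt_prodMk_right _ _
  have h2 := hd.hasFDerivAt.comp (constCurve E x₀) h1
  have h3 : HasFDerivAt (flowEquation f ∘ fun γ : C(I, E) => (((0 : ℝ), x₀), γ))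
      (ContinuousLinearMap.id ℝ C(I, E)) (constCurve E x₀) := by
    have : (flowEquation f ∘ fun γ : C(I, E) => (((0 : ℝ), x₀), γ)) =
        fun γ => γ - constCurve E x₀ := by
      funext γ
      simp [flowEquation]
    rw [this]
    exact (hasFDerivAt_id _).sub_const _
  rw [h2.unique h3]
  exact ⟨ContinuousLinearEquiv.refl ℝ _, rfl⟩

/-- A smooth vector field on a Banach space has a smooth local flow. -/
theorem exists_local_flow (f : E → E) (hf : ContDiff ℝ ∞ f) (x₀ : E) :
    ∃ (Φ : ℝ × E → E) (ε : ℝ), 0 < ε ∧ (∀ n : ℕ, ContDiffAt ℝ n Φ (0, x₀)) ∧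
      ∀ x ∈ Metric.ball x₀ ε, Φ (0, x) = x ∧
        ∀ s ∈ Ioo (-ε) ε, HasDerivAt (fun s => Φ (s, x)) (f (Φ (s, x))) s := by
  let F : C(E, E) := ⟨f, hf.continuous⟩
  have hF (n : ℕ) : ContDiff ℝ n F := hf.of_le (by exact_mod_cast le_top)
  have hG (n : ℕ) := contDiff_flowEquation F n (hF n)
  have hinv := isInvertible_fderiv_flowEquation F (by exact_mod_cast hF 1) x₀
  set u : (ℝ × E) × C(I, E) := ((0, x₀), constCurve E x₀) with hu
  have hu0 : flowEquation F u = 0 := by simp [flowEquation, hu]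
  set g := ((hG 1).contDiffAt (x := u)).implicitFunction (by simp) hinv with hg
  -- The same g serves for every order. The order is raised to n + 1 because the theorem requires a
  -- nonzero one.
  have hgn (n : ℕ) : ContDiffAt ℝ n g (0, x₀) := by
    have h1 : ContDiffAt ℝ (n + 1 : ℕ) g (0, x₀) :=
      ((hG (n + 1)).contDiffAt (x := u)).contDiffAt_implicitFunction
        (by exact_mod_cast Nat.succ_ne_zero n) hinv
    exact h1.of_le (by exact_mod_cast Nat.le_succ n)
  have hgu : g (0, x₀) = constCurve E x₀ := ContDiffAt.implicitFunction_apply_self _ _ _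
  have hg0 : ∀ᶠ p in 𝓝 (0, x₀), flowEquation F (p, g p) = 0 := by
    have := ContDiffAt.eventually_apply_implicitFunction ((hG 1).contDiffAt (x := u))
      (by simp) hinv
    rw [hu0] at this
    exact this
  have hiff := ContDiffAt.eventually_apply_eq_iff_implicitFunction ((hG 1).contDiffAt (x := u))
      (by simp) hinv
  rw [hu0] at hiff
  obtain ⟨δ, hδ, Hδ⟩ := Metric.eventually_nhds_iff.1 hiff
  have hcont : ∀ᶠ p in 𝓝 ((0 : ℝ), x₀), ContinuousAt g p := by
    filter_upwards [(hgn 1).eventually (by simp)] with p hp using hp.continuousAt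
  have hclose : ∀ᶠ p in 𝓝 ((0 : ℝ), x₀), dist (g p) (constCurve E x₀) < δ := by
    have := (hgn 0).continuousAt.eventually (Metric.ball_mem_nhds _ hδ)
    rw [hgu] at this
    exact this
  obtain ⟨ε', hε', Hε'⟩ := Metric.eventually_nhds_iff.1 (hg0.and (hcont.and hclose))
  set ε := min ε' δ with hε
  have hε0 : 0 < ε := lt_min hε' hδ
  have hball : ∀ {s : ℝ} {x : E}, s ∈ Ioo (-ε) ε → x ∈ Metric.ball x₀ ε →
      flowEquation F ((s, x), g (s, x)) = 0 ∧ ContinuousAt g (s, x) ∧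
        dist (g (s, x)) (constCurve E x₀) < δ := by
    intro s x hs hx
    refine Hε' ?_
    rw [Prod.dist_eq, max_lt_iff, Real.dist_eq, sub_zero, abs_lt]
    exact ⟨⟨(neg_le_neg (min_le_left _ _)).trans_lt hs.1, hs.2.trans_le (min_le_left _ _)⟩,
      lt_of_lt_of_le hx (min_le_left _ _)⟩
  have hmulmem : ∀ {s : ℝ} (τ : I), s ∈ Ioo (-ε) ε → (τ : ℝ) * s ∈ Ioo (-ε) ε := by
    intro s τ hs
    rw [mem_Ioo, ← abs_lt, abs_mul, abs_of_nonneg τ.2.1]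
    exact (mul_le_of_le_one_left (abs_nonneg _) τ.2.2).trans_lt (abs_lt.2 hs)
  -- Both sides solve the equation for time τ s and are δ-close to the constant curve, so the
  -- uniqueness part of the implicit function theorem identifies them.
  have hslow : ∀ {s : ℝ} {x : E} (τ : I), s ∈ Ioo (-ε) ε → x ∈ Metric.ball x₀ ε →
      g (τ * s, x) = slowDown τ (g (s, x)) := by
    intro s x τ hs hx
    obtain ⟨h0, -, hd⟩ := hball hs hx
    refine (Hδ (y := ((τ * s, x), slowDown τ (g (s, x)))) ?_).1 ?_
    · rw [Prod.dist_eq, Prod.dist_eq, max_lt_iff, max_lt_iff, Real.dist_eq, sub_zero]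
      refine ⟨⟨(abs_lt.2 (hmulmem τ hs)).trans_le (min_le_right _ _),
        lt_of_lt_of_le hx (min_le_right _ _)⟩, lt_of_le_of_lt ?_ hd⟩
      rw [ContinuousMap.dist_le dist_nonneg]
      intro r
      exact ContinuousMap.dist_apply_le_dist (f := g (s, x)) (g := constCurve E x₀) (τ * r)
    · rw [flowEquation_slowDown, h0]
      rfl
  have heval : ∀ {s : ℝ} {x : E} (τ : I), s ∈ Ioo (-ε) ε → x ∈ Metric.ball x₀ ε →
      g (s, x) τ = g (s * τ, x) 1 := by
    intro s x τ hs hx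
    rw [mul_comm, hslow τ hs hx]
    change _ = g (s, x) (τ * 1)
    rw [mul_one]
  have hint : ∀ {s : ℝ} {x : E}, s ∈ Ioo (-ε) ε → x ∈ Metric.ball x₀ ε →
      g (s, x) 1 = x + ∫ r in (0 : ℝ)..s, f (g (r, x) 1) := by
    intro s x hs hx
    have h0 : (flowEquation F ((s, x), g (s, x))) 1 = 0 := by rw [(hball hs hx).1]; rfl
    have h1 : g (s, x) 1 - x - s • primitive E (F.comp (g (s, x))) 1 = 0 := h0
    rw [primitive_apply] at h1
    have h2 : ∫ r in (0 : ℝ)..(1 : I), (F.comp (g (s, x))) (projIcc 0 1 zero_le_one r) =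
        ∫ r in (0 : ℝ)..(1 : ℝ), (fun q => f (g (q, x) 1)) (s * r) := by
      refine intervalIntegral.integral_congr (fun r hr => ?_)
      replace hr : r ∈ Icc (0 : ℝ) 1 := by rwa [← uIcc_of_le zero_le_one]
      change f (g (s, x) (projIcc 0 1 zero_le_one r)) = f (g (s * r, x) 1)
      rw [heval _ hs hx, projIcc_of_mem _ hr]
    rw [h2, intervalIntegral.smul_integral_comp_mul_left (fun q => f (g (q, x) 1)) s, mul_zero, mul_one,
      sub_sub,
      sub_eq_zero] at h1
    exact h1
  -- The flow is the endpoint of the rescaled curve; `hint` is its integral equation in s.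
  refine ⟨fun p => g p 1, ε, hε0, fun n => ?_, fun x hx => ⟨?_, fun s hs => ?_⟩⟩
  · exact (((ContinuousMap.evalCLM ℝ (1 : I)).contDiff (n := n)).contDiffAt
      (x := g (0, x₀))).comp (0, x₀) (hgn n)
  · change g (0, x) 1 = x
    rw [hint ⟨neg_lt_zero.2 hε0, hε0⟩ hx]
    simp
  · have hc : ContinuousOn (fun r => f (g (r, x) 1)) (Ioo (-ε) ε) := by
      intro r hr
      have h1 : ContinuousAt (fun r : ℝ => g (r, x)) r :=
        ContinuousAt.comp (g := g) (hball hr hx).2.1 (by fun_prop)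
      have h2 : ContinuousAt (fun r : ℝ => g (r, x) 1) r :=
        ContinuousAt.comp (g := fun γ : C(I, E) => γ 1)
          (continuous_eval_const (1 : I)).continuousAt h1
      exact (hf.continuous.continuousAt.comp h2).continuousWithinAt
    have h0 : (0 : ℝ) ∈ Ioo (-ε) ε := ⟨neg_lt_zero.2 hε0, hε0⟩
    have hd := intervalIntegral.integral_hasDerivAt_right
      ((hc.mono (ordConnected_Ioo.uIcc_subset h0 hs)).intervalIntegrable)
      (hc.stronglyMeasurableAtFilter isOpen_Ioo s hs)
      (hc.continuousAt (Ioo_mem_nhds hs.1 hs.2))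
    refine (hd.const_add x).congr_of_eventuallyEq ?_
    filter_upwards [Ioo_mem_nhds hs.1 hs.2] with r hr using hint hr hx

end LocalFlow

/-! ### Vector fields as derivations, brackets as commutators -/

section FieldDeriv

variable {n : ℕ} {M : Type*} [TopologicalSpace M] [ChartedSpace (Model n) M]
  [IsManifold (𝓡 n) ∞ M]

theorem fieldDeriv_apply (X : SmoothField n M) (f : SmoothFun n M) (x : M) :
    fieldDeriv X f x = mvfderiv (𝓡 n) f x (X x) := rfl

omit [IsManifold (𝓡 n) ∞ M] in
theorem SmoothFun.mdifferentiableAt (f : SmoothFun n M) (x : M) :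
    MDifferentiableAt (𝓡 n) 𝓘(ℝ, ℝ) f x := (f.contMDiff x).mdifferentiableAt (by simp)

theorem fieldDeriv_mul (X : SmoothField n M) (f g : SmoothFun n M) :
    fieldDeriv X (f * g) = fieldDeriv X f * g + f * fieldDeriv X g := by
  ext x
  have := mvfderiv_mul (f.mdifferentiableAt x) (g.mdifferentiableAt x)
  change mvfderiv (𝓡 n) (⇑f * ⇑g) x (X x) = fieldDeriv X f x * g x + f x * fieldDeriv X g x
  rw [this, fieldDeriv_apply, fieldDeriv_apply]
  simp only [add_apply, smul_apply, smul_eq_mul]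
  ring

/-- A vector field in the preferred chart at `x`. -/
def chartField (X : SmoothField n M) (x : M) : Model n → Model n :=
  VectorField.mpullbackWithin 𝓘(ℝ, Model n) (𝓡 n) (extChartAt (𝓡 n) x).symm X (range (𝓡 n))

theorem differentiableAt_chartField (X : SmoothField n M) (x : M) :
    DifferentiableAt ℝ (chartField X x) (extChartAt (𝓡 n) x x) := by
  have h : DifferentiableWithinAt ℝ (chartField X x) (univ ∩ range (𝓡 n))
      (extChartAt (𝓡 n) x x) :=
    (X.mdifferentiableAt (x := x)).mdifferentiableWithinAt (s := univ)
      |>.differentiableWithinAt_mpullbackWithin_vectorField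
  rwa [ModelWithCorners.range_eq_univ, univ_inter, differentiableWithinAt_univ] at h

theorem mlieBracket_eq_lieBracket_chartField (X Y : SmoothField n M) (x : M) :
    VectorField.mlieBracket (𝓡 n) X Y x =
      VectorField.lieBracket ℝ (chartField X x) (chartField Y x) (extChartAt (𝓡 n) x x) := by
  rw [← VectorField.mlieBracketWithin_univ, VectorField.mlieBracketWithin_apply,
    mfderiv_extChartAt_self]
  have h1 : (ContinuousLinearMap.id ℝ (Model n)).inverse (VectorField.lieBracketWithin ℝ
      (chartField X x) (chartField Y x) (univ ∩ range (𝓡 n)) (extChartAt (𝓡 n) x x)) =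
      VectorField.lieBracket ℝ (chartField X x) (chartField Y x) (extChartAt (𝓡 n) x x) := by
    rw [ContinuousLinearMap.inverse_id, ModelWithCorners.range_eq_univ, univ_inter,
      VectorField.lieBracketWithin_univ]
    rfl
  exact h1

theorem fderiv_chartField (X : SmoothField n M) (f : SmoothFun n M) (x : M) {y : Model n}
    (hy : y ∈ (extChartAt (𝓡 n) x).target) :
    fderiv ℝ (f ∘ (extChartAt (𝓡 n) x).symm) y (chartField X x y) =
      fieldDeriv X f ((extChartAt (𝓡 n) x).symm y) := by
  have hinv := isInvertible_mfderivWithin_extChartAt_symm (I := 𝓡 n) hy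
  have h1 := mvfderiv_comp_mfderivWithin (I := 𝓡 n) (I' := 𝓘(ℝ, Model n)) y
    (f.mdifferentiableAt ((extChartAt (𝓡 n) x).symm y))
    (mdifferentiableWithinAt_extChartAt_symm hy) (by simpa using uniqueMDiffWithinAt_univ _)
  have h2 : mvfderivWithin 𝓘(ℝ, Model n) (f ∘ (extChartAt (𝓡 n) x).symm) (range (𝓡 n)) y =
      fderiv ℝ (f ∘ (extChartAt (𝓡 n) x).symm) y := by
    rw [ModelWithCorners.range_eq_univ, mvfderivWithin_univ]
    exact mfderiv_eq_fderiv
  rw [← h2, h1, chartField, VectorField.mpullbackWithin_apply]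
  obtain ⟨e, he⟩ := hinv
  rw [← he, ContinuousLinearMap.inverse_equiv]
  change mvfderiv (𝓡 n) f _ (e (e.symm _)) = _
  rw [e.apply_symm_apply]
  rfl

/-- The Lie bracket acts on functions as the commutator of derivations. -/
theorem mvfderiv_mlieBracket (X Y : SmoothField n M) (f : SmoothFun n M) (x : M) :
    mvfderiv (𝓡 n) f x (VectorField.mlieBracket (𝓡 n) X Y x) =
      fieldDeriv X (fieldDeriv Y f) x - fieldDeriv Y (fieldDeriv X f) x := by
  have hx : extChartAt (𝓡 n) x x ∈ (extChartAt (𝓡 n) x).target := mem_extChartAt_target x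
  have hsymm : (extChartAt (𝓡 n) x).symm (extChartAt (𝓡 n) x x) = x := extChartAt_to_inv x
  have hd : ContDiffAt ℝ 2 (f ∘ (extChartAt (𝓡 n) x).symm) (extChartAt (𝓡 n) x x) := by
    have h1 := (contMDiffOn_extChartAt_symm (I := 𝓡 n) (n := ∞) x).contMDiffAt
      ((isOpen_extChartAt_target x).mem_nhds hx)
    have h2 := ContMDiffAt.comp (extChartAt (𝓡 n) x x) (f.contMDiff _) h1
    exact h2.contDiffAt.of_le (by norm_cast)
  have hf : mvfderiv (𝓡 n) f x =
      fderiv ℝ (f ∘ (extChartAt (𝓡 n) x).symm) (extChartAt (𝓡 n) x x) := by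
    rw [(f.mdifferentiableAt x).mvfderiv, ModelWithCorners.range_eq_univ, fderivWithin_univ]
    rfl
  have hval (Z W : SmoothField n M) :
      fderiv ℝ (fun y => fderiv ℝ (f ∘ (extChartAt (𝓡 n) x).symm) y (chartField Z x y))
        (extChartAt (𝓡 n) x x) (chartField W x (extChartAt (𝓡 n) x x)) =
        fieldDeriv W (fieldDeriv Z f) x := by
    have h1 := fderiv_chartField W (fieldDeriv Z f) x hx
    rw [hsymm] at h1
    rw [← h1]
    congr 1
    refine Filter.EventuallyEq.fderiv_eq ?_
    filter_upwards [(isOpen_extChartAt_target (I := 𝓡 n) x).mem_nhds hx] with y hy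
    exact fderiv_chartField Z f x hy
  have := VectorField.fderiv_apply_lieBracket (𝕜 := ℝ) hd (by simp)
    (differentiableAt_chartField Y x) (differentiableAt_chartField X x)
  rw [hval, hval] at this
  rw [mlieBracket_eq_lieBracket_chartField, hf]
  exact this

/-- Near each point there are functions whose differentials are dual to some vector fields. -/
theorem exists_dual_frame_nhds [T2Space M] (p : M) :
    ∃ (f : Fin n → SmoothFun n M) (X : Fin n → SmoothField n M),
      ∀ᶠ y in 𝓝 p, ∀ v : TangentSpace (𝓡 n) y, ∑ j, mvfderiv (𝓡 n) (f j) y v • X j y = v := by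
  let b : SmoothBumpFunction (𝓡 n) p := Classical.arbitrary _
  have hcoord (j : Fin n) : ContMDiffOn (𝓡 n) 𝓘(ℝ, ℝ) ∞ (fun y => (extChartAt (𝓡 n) p y) j)
      (chartAt (Model n) p).source := by
    have h1 : ContDiff ℝ ∞ (fun z : Model n => z j) := by fun_prop
    exact h1.contMDiff.comp_contMDiffOn (contMDiffOn_extChartAt (I := 𝓡 n) (x := p))
  -- Coordinate functions and the coordinate frame are both multiplied by the bump function b. Near
  -- p, where b = 1, they are dual to each other.
  let f (j : Fin n) : SmoothFun n M :=
    ⟨fun y => b y • (extChartAt (𝓡 n) p y) j, b.contMDiff_smul (hcoord j)⟩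
  let e := trivializationAt (Model n) (TangentSpace (𝓡 n)) p
  let B := (EuclideanSpace.basisFun (Fin n) ℝ).toBasis
  have hbase : e.baseSet = (chartAt (Model n) p).source := rfl
  let X (j : Fin n) : SmoothField n M :=
    ⟨(b : M → ℝ) • e.localFrame B j, ContMDiffOn.smul_section_of_tsupport (u := e.baseSet)
      b.contMDiff.contMDiffOn e.open_baseSet (hbase ▸ b.tsupport_subset_chartAt_source)
      (e.contMDiffOn_localFrame_baseSet ∞ B j)⟩
  refine ⟨f, X, ?_⟩
  filter_upwards [b.eventuallyEq_one.eventuallyEq_nhds,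
    e.open_baseSet.mem_nhds (mem_baseSet_trivializationAt _ _ p)] with y hb hy v
  have hys : y ∈ (chartAt (Model n) p).source := hy
  have hw (j : Fin n) : mvfderiv (𝓡 n) (f j) y v = (e.continuousLinearMapAt ℝ y v) j := by
    have h1 : f j =ᶠ[𝓝 y] (fun z : Model n => z j) ∘ extChartAt (𝓡 n) p := by
      filter_upwards [hb] with z hz
      change b z • (extChartAt (𝓡 n) p z) j = _
      rw [hz]
      simp
    have hc : DifferentiableAt ℝ (fun z : Model n => z j) (extChartAt (𝓡 n) p y) := by fun_prop
    have h2 := mvfderiv_comp_apply (I := 𝓘(ℝ, Model n)) (I' := 𝓡 n) y hc.mdifferentiableAt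
      (mdifferentiableAt_extChartAt hys) v
    have h3 : mvfderiv (𝓡 n) (f j) y =
        mvfderiv (𝓡 n) ((fun z : Model n => z j) ∘ extChartAt (𝓡 n) p) y := by
      exact h1.mfderiv_eq
    rw [h3, h2, TangentBundle.continuousLinearMapAt_trivializationAt hys]
    have h4 : HasFDerivAt (fun z : Model n => z j)
        (EuclideanSpace.proj (𝕜 := ℝ) j : Model n →L[ℝ] ℝ) (extChartAt (𝓡 n) p y) :=
      (EuclideanSpace.proj (𝕜 := ℝ) j : Model n →L[ℝ] ℝ).hasFDerivAt
    have h5 : mvfderiv 𝓘(ℝ, Model n) (fun z : Model n => z j) (extChartAt (𝓡 n) p y) =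
        (EuclideanSpace.proj (𝕜 := ℝ) j : Model n →L[ℝ] ℝ) := by
      rw [← h4.fderiv]
      exact mfderiv_eq_fderiv
    rw [h5]
    rfl
  have hX (j : Fin n) : X j y = (e.linearEquivAt ℝ y hy).symm (B j) := by
    change b y • e.localFrame B j y = _
    rw [hb.eq_of_nhds, e.localFrame_apply_of_mem_baseSet B hy]
    simp [Bundle.Trivialization.basisAt]
  have hv : e.continuousLinearMapAt ℝ y v = e.linearEquivAt ℝ y hy v := by
    rw [Bundle.Trivialization.continuousLinearMapAt_apply,
      Bundle.Trivialization.coe_linearMapAt_of_mem e hy]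
    rfl
  simp only [hw, hX, hv]
  apply (e.linearEquivAt ℝ y hy).injective
  simp only [map_sum, map_smul, LinearEquiv.apply_symm_apply]
  exact B.sum_repr (e.linearEquivAt ℝ y hy v)

/-- Vector fields are determined by their action on functions. -/
theorem eq_zero_of_forall_mvfderiv_eq_zero [T2Space M] {x : M} (v : TangentSpace (𝓡 n) x)
    (h : ∀ f : SmoothFun n M, mvfderiv (𝓡 n) f x v = 0) : v = 0 := by
  obtain ⟨f, X, hX⟩ := exists_dual_frame_nhds (n := n) x
  rw [← hX.self_of_nhds v]
  simp [h]

end FieldDeriv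

/-! ### Identities at infinity and the maximum principle -/

section Infinity

variable {n : ℕ} {M : Type*} [TopologicalSpace M] [ChartedSpace (Model n) M]

/-- Two functions agree off a compact set. -/
def EqInf (f g : SmoothFun n M) : Prop := ∀ᶠ x in cocompact M, f x = g x

theorem EqInf.symm {f g : SmoothFun n M} (h : EqInf f g) : EqInf g f := h.mono fun _ => Eq.symm

theorem EqInf.trans {f g k : SmoothFun n M} (h : EqInf f g) (h' : EqInf g k) : EqInf f k := by
  filter_upwards [h, h'] with x h1 h2 using h1.trans h2

theorem SmoothFun.add_apply (f g : SmoothFun n M) (x : M) : (f + g) x = f x + g x := rfl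
theorem SmoothFun.sub_apply (f g : SmoothFun n M) (x : M) : (f - g) x = f x - g x := rfl
theorem SmoothFun.mul_apply (f g : SmoothFun n M) (x : M) : (f * g) x = f x * g x := rfl
theorem SmoothFun.zero_apply (x : M) : (0 : SmoothFun n M) x = 0 := rfl
theorem SmoothFun.smul_apply (c : ℝ) (f : SmoothFun n M) (x : M) : (c • f) x = c * f x := rfl
theorem SmoothFun.neg_apply (f : SmoothFun n M) (x : M) : (-f) x = - f x := rfl

theorem SmoothFun.sum_apply {ι : Type*} (s : Finset ι) (f : ι → SmoothFun n M) (x : M) :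
    (∑ i ∈ s, f i) x = ∑ i ∈ s, f i x :=
  map_sum (ContMDiffMap.evalRingHom (I := 𝓡 n) (R := ℝ) (n := ∞) x) f s

theorem SmoothFun.prod_apply {ι : Type*} (s : Finset ι) (f : ι → SmoothFun n M) (x : M) :
    (∏ i ∈ s, f i) x = ∏ i ∈ s, f i x :=
  map_prod (ContMDiffMap.evalRingHom (I := 𝓡 n) (R := ℝ) (n := ∞) x) f s

theorem SmoothFun.pow_apply (f : SmoothFun n M) (k : ℕ) (x : M) : (f ^ k) x = f x ^ k :=
  map_pow (ContMDiffMap.evalRingHom (I := 𝓡 n) (R := ℝ) (n := ∞) x) f k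

theorem eventually_cocompact_iff {P : M → Prop} :
    (∀ᶠ x in cocompact M, P x) ↔ ∃ K : Set M, IsCompact K ∧ ∀ x ∉ K, P x :=
  hasBasis_cocompact.eventually_iff

theorem eventually_eventually_nhds_cocompact [T2Space M] {P : M → Prop}
    (h : ∀ᶠ x in cocompact M, P x) : ∀ᶠ x in cocompact M, ∀ᶠ y in 𝓝 x, P y := by
  obtain ⟨K, hK, hP⟩ := eventually_cocompact_iff.1 h
  refine eventually_cocompact_iff.2 ⟨K, hK, fun x hx => ?_⟩
  filter_upwards [hK.isClosed.isOpen_compl.mem_nhds hx] with y hy using hP y hy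

theorem exists_forall_le_of_eventually {τ : SmoothFun n M} {P : M → Prop}
    (h : ∀ᶠ x in cocompact M, P x) (b : ℝ) : ∃ a, b ≤ a ∧ ∀ x, a ≤ τ x → P x := by
  obtain ⟨K, hK, hP⟩ := eventually_cocompact_iff.1 h
  obtain ⟨C, hC⟩ := (hK.image τ.contMDiff.continuous).bddAbove
  refine ⟨max b (C + 1), le_max_left _ _, fun x hx => hP x fun hxK => ?_⟩
  have h1 := hC (mem_image_of_mem τ hxK)
  have h2 := (le_max_right b (C + 1)).trans hx
  linarith

theorem isCompact_preimage_Icc {τ : SmoothFun n M} (hτ : Tendsto τ (cocompact M) atTop)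
    (a b : ℝ) : IsCompact (τ ⁻¹' Icc a b) := by
  obtain ⟨K, hK, hP⟩ := eventually_cocompact_iff.1 (hτ.eventually_gt_atTop b)
  refine hK.of_isClosed_subset (isClosed_Icc.preimage τ.contMDiff.continuous) fun x hx => ?_
  by_contra hxK
  exact absurd hx.2 (not_le.2 (hP x hxK))

variable [IsManifold (𝓡 n) ∞ M]

/-- A vector field acts on functions as a derivation. -/
def fieldDerivation (X : SmoothField n M) : Derivation ℝ (SmoothFun n M) (SmoothFun n M) :=
  Derivation.mk' (fieldDeriv X) fun f g => by
    rw [fieldDeriv_mul, smul_eq_mul, smul_eq_mul, add_comm, mul_comm g]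

theorem fieldDeriv_pow (X : SmoothField n M) (f : SmoothFun n M) (k : ℕ) (x : M) :
    fieldDeriv X (f ^ k) x = k * f x ^ (k - 1) * fieldDeriv X f x := by
  have h := (fieldDerivation X).leibniz_pow f k
  have h2 : fieldDeriv X (f ^ k) = (k : ℝ) • (f ^ (k - 1) * fieldDeriv X f) := by
    rw [Nat.cast_smul_eq_nsmul]
    exact h
  rw [h2, SmoothFun.smul_apply, SmoothFun.mul_apply, SmoothFun.pow_apply, mul_assoc]

theorem fieldDeriv_add_field (X Y : SmoothField n M) (f : SmoothFun n M) :
    fieldDeriv (X + Y) f = fieldDeriv X f + fieldDeriv Y f := by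
  ext x
  exact map_add (mvfderiv (𝓡 n) f x) (X x) (Y x)

theorem EqInf.fieldDeriv [T2Space M] {f g : SmoothFun n M} (h : EqInf f g) (X : SmoothField n M) :
    EqInf (fieldDeriv X f) (fieldDeriv X g) := by
  filter_upwards [eventually_eventually_nhds_cocompact h] with x hx
  have : f =ᶠ[𝓝 x] g := hx
  have h1 : mvfderiv (𝓡 n) f x = mvfderiv (𝓡 n) g x := this.mfderiv_eq
  rw [fieldDeriv_apply, h1, fieldDeriv_apply]

theorem fieldDeriv_of_eventually_const [T2Space M] {f : SmoothFun n M} {c : ℝ}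
    (h : ∀ᶠ x in cocompact M, f x = c) (X : SmoothField n M) : EqInf (fieldDeriv X f) 0 := by
  filter_upwards [eventually_eventually_nhds_cocompact h] with x hx
  have : f =ᶠ[𝓝 x] fun _ => c := hx
  have h1 : mvfderiv (𝓡 n) f x = mvfderiv (𝓡 n) (fun _ => c) x := this.mfderiv_eq
  rw [fieldDeriv_apply, h1, mvfderiv_const]
  rfl

/-- The commutator of two vector fields applied to a function. -/
def bracketDeriv (X Y : SmoothField n M) (f : SmoothFun n M) : SmoothFun n M :=
  fieldDeriv X (fieldDeriv Y f) - fieldDeriv Y (fieldDeriv X f)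

theorem bracketDeriv_apply (X Y : SmoothField n M) (f : SmoothFun n M) (x : M) :
    bracketDeriv X Y f x = mvfderiv (𝓡 n) f x (VectorField.mlieBracket (𝓡 n) X Y x) :=
  (mvfderiv_mlieBracket X Y f x).symm

theorem IsConstantField.eventually {T X : SmoothField n M} (h : IsConstantField T X) :
    ∀ᶠ x in cocompact M, VectorField.mlieBracket (𝓡 n) X T x = 0 :=
  eventually_cocompact_iff.2 h

theorem IsConstantField.bracketDeriv_eq {T X : SmoothField n M} (h : IsConstantField T X)
    (f : SmoothFun n M) : EqInf (bracketDeriv X T f) 0 := by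
  filter_upwards [h.eventually] with x hx
  rw [bracketDeriv_apply, hx, map_zero]
  rfl

theorem IsConstantField.comm {T X : SmoothField n M} (h : IsConstantField T X)
    (f : SmoothFun n M) : EqInf (CylEnd.fieldDeriv X (CylEnd.fieldDeriv T f))
      (CylEnd.fieldDeriv T (CylEnd.fieldDeriv X f)) := by
  filter_upwards [h.bracketDeriv_eq f] with x hx
  exact sub_eq_zero.1 hx

omit [IsManifold (𝓡 n) ∞ M] in
/-- The derivative of a function along an integral curve. -/
theorem hasDerivAt_comp_integralCurve {v : Π x : M, TangentSpace (𝓡 n) x} {γ : ℝ → M} {s : ℝ}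
    (hγ : IsMIntegralCurveAt γ v s) {F : M → ℝ} (hF : MDifferentiableAt (𝓡 n) 𝓘(ℝ, ℝ) F (γ s)) :
    HasDerivAt (F ∘ γ) (mvfderiv (𝓡 n) F (γ s) (v (γ s))) s := by
  have h1 := hF.hasMFDerivAt.comp s hγ.hasMFDerivAt
  have h2 : HasFDerivAt (F ∘ γ) ((mvfderiv (𝓡 n) F (γ s) : Model n →L[ℝ] ℝ).comp
      ((1 : ℝ →L[ℝ] ℝ).smulRight (v (γ s) : Model n))) s := h1.hasFDerivAt
  have h3 := h2.hasDerivAt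
  rwa [ContinuousLinearMap.comp_apply, ContinuousLinearMap.smulRight_apply,
    one_apply_eq_self, one_smul] at h3

theorem HasDerivAt.eventually_lt_left {u : ℝ → ℝ} {d : ℝ} (h : HasDerivAt u d 0) (hd : d < 0) :
    ∀ᶠ s in 𝓝[<] 0, u 0 < u s := by
  have h1 := (hasDerivAt_iff_tendsto_slope.1 h).eventually_lt_const hd
  have h2 : ∀ᶠ s in 𝓝[<] (0 : ℝ), slope u 0 s < 0 :=
    h1.filter_mono (nhdsWithin_mono _ fun s hs => ne_of_lt hs)
  filter_upwards [h2, self_mem_nhdsWithin] with s hs hs0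
  rw [slope_def_field, sub_zero, div_neg_iff] at hs
  rcases hs with ⟨h3, -⟩ | ⟨-, h3⟩
  · linarith
  · exact absurd h3 (not_lt.2 (le_of_lt hs0))

/-- A maximum principle for a transport equation on a cylindrical end. -/
theorem transport_max_principle [T2Space M] {τ : SmoothFun n M}
    (hτ : Tendsto τ (cocompact M) atTop)
    (Y : SmoothField n M) {a B : ℝ} (F : M → ℝ)
    (hF : ∀ x, a ≤ τ x → MDifferentiableAt (𝓡 n) 𝓘(ℝ, ℝ) F x)
    (hY : ∀ x, a ≤ τ x → fieldDeriv Y τ x = 1)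
    (hneg : ∀ x, a ≤ τ x → B < F x → mvfderiv (𝓡 n) F x (Y x) < 0)
    (hB : ∀ x, τ x = a → F x ≤ B) {x : M} (hx : a ≤ τ x) : F x ≤ B := by
  by_contra! hlt
  -- From a maximum point z of F on the slab a ≤ τ ≤ τ x, necessarily with τ z > a, a short step
  -- backwards along Y stays in the slab and increases F. Only a local integral curve is needed.
  obtain ⟨z, hz, hmax⟩ := (isCompact_preimage_Icc hτ a (τ x)).exists_isMaxOn ⟨x, hx, le_rfl⟩
    (fun y hy => (hF y hy.1).continuousAt.continuousWithinAt)
  have hBz : B < F z := hlt.trans_le (hmax (⟨hx, le_rfl⟩ : x ∈ τ ⁻¹' Icc a (τ x)))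
  have haz : a < τ z := by
    refine lt_of_le_of_ne hz.1 fun h => ?_
    exact absurd (hB z h.symm) (not_le.2 hBz)
  obtain ⟨γ, hγ0, hγ⟩ := exists_isMIntegralCurveAt_of_contMDiffAt_boundaryless (I := 𝓡 n)
    (v := Y) 0 (Y.contMDiff.contMDiffAt.of_le (by simp) : ContMDiffAt (𝓡 n) (𝓡 n).tangent 1
      (fun y => (⟨y, Y y⟩ : TangentBundle (𝓡 n) M)) z)
  have h1 := hasDerivAt_comp_integralCurve hγ (F := F) (by rw [hγ0]; exact hF z hz.1)
  have h2 := hasDerivAt_comp_integralCurve hγ (F := fun y => - τ y)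
    ((-τ).mdifferentiableAt _)
  have h3 := hasDerivAt_comp_integralCurve hγ (τ.mdifferentiableAt _)
  rw [hγ0] at h1 h3
  have h3' : HasDerivAt (τ ∘ γ) 1 0 := by
    rw [← hY z hz.1]
    exact h3
  have e1 := HasDerivAt.eventually_lt_left h1 (hneg z hz.1 hBz)
  have e2 := HasDerivAt.eventually_lt_left h3'.neg (by norm_num)
  have e3 : ∀ᶠ s in 𝓝[<] 0, a < (τ ∘ γ) s := by
    have hc : ContinuousAt (τ ∘ γ) 0 := h3'.continuousAt
    refine (hc.eventually_const_lt ?_).filter_mono nhdsWithin_le_nhds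
    simpa [hγ0] using haz
  obtain ⟨s, hs1, hs2, hs3⟩ := (e1.and (e2.and e3)).exists
  simp only [Function.comp_apply, hγ0, Pi.neg_apply, neg_lt_neg_iff] at hs1 hs2 hs3
  exact absurd (hmax (⟨hs3.le, hs2.le.trans hz.2⟩ : γ s ∈ τ ⁻¹' Icc a (τ x))) (not_le.2 hs1)

end Infinity

/-! ### Polynomial growth and O(1 / τ) decay -/

section Growth

variable {n : ℕ} {M : Type*} [TopologicalSpace M] [ChartedSpace (Model n) M]

/-- `h` grows at most polynomially in `τ`. -/
def Growth (τ h : M → ℝ) : Prop :=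
  ∃ (N : ℕ) (C : ℝ), ∀ᶠ x in cocompact M, |h x| ≤ C * τ x ^ N

/-- `h` is `O(1 / τ)`. -/
def Small (τ h : M → ℝ) : Prop := ∃ C : ℝ, ∀ᶠ x in cocompact M, |τ x * h x| ≤ C

/-- `h` is bounded off a compact set. -/
def BoundedInf (h : M → ℝ) : Prop := ∃ C : ℝ, ∀ᶠ x in cocompact M, |h x| ≤ C

variable {τ : M → ℝ} (hτ : Tendsto τ (cocompact M) atTop)

theorem Growth.congr {f g : M → ℝ} (hf : Growth τ f) (h : ∀ᶠ x in cocompact M, g x = f x) :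
    Growth τ g := by
  obtain ⟨N, C, H⟩ := hf
  refine ⟨N, C, ?_⟩
  filter_upwards [H, h] with x h1 h2
  rwa [h2]

theorem BoundedInf.growth {f : M → ℝ} (hf : BoundedInf f) : Growth τ f := by
  obtain ⟨C, H⟩ := hf
  exact ⟨0, C, by simpa using H⟩

include hτ in
theorem Growth.exists_ge {f : M → ℝ} (hf : Growth τ f) :
    ∃ N₀ : ℕ, ∃ C₀ : ℝ, ∀ N ≥ N₀, ∀ C ≥ C₀, ∀ᶠ x in cocompact M, |f x| ≤ C * τ x ^ N := by
  obtain ⟨N, C, H⟩ := hf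
  refine ⟨N, |C|, fun N' hN C' hC => ?_⟩
  filter_upwards [H, hτ.eventually_ge_atTop 1] with x h1 h2
  refine h1.trans (mul_le_mul ((le_abs_self C).trans hC) (pow_le_pow_right₀ h2 hN)
    (by positivity) ((abs_nonneg C).trans hC))

include hτ in
theorem Growth.add {f g : M → ℝ} (hf : Growth τ f) (hg : Growth τ g) :
    Growth τ (fun x => f x + g x) := by
  obtain ⟨N, C, H⟩ := hf.exists_ge hτ
  obtain ⟨N', C', H'⟩ := hg.exists_ge hτ
  refine ⟨max N N', max C C' + max C C', ?_⟩
  filter_upwards [H _ (le_max_left N N') _ (le_max_left C C'),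
    H' _ (le_max_right N N') _ (le_max_right C C')] with x h1 h2
  rw [add_mul]
  exact (abs_add_le _ _).trans (add_le_add h1 h2)

theorem Growth.mul {f g : M → ℝ} (hf : Growth τ f) (hg : Growth τ g) :
    Growth τ (fun x => f x * g x) := by
  obtain ⟨N, C, H⟩ := hf
  obtain ⟨N', C', H'⟩ := hg
  refine ⟨N + N', C * C', ?_⟩
  filter_upwards [H, H'] with x h1 h2
  rw [abs_mul, pow_add, mul_mul_mul_comm]
  exact mul_le_mul h1 h2 (abs_nonneg _) ((abs_nonneg _).trans h1)

theorem Small.add {f g : M → ℝ} (hf : Small τ f) (hg : Small τ g) :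
    Small τ (fun x => f x + g x) := by
  obtain ⟨C, H⟩ := hf
  obtain ⟨C', H'⟩ := hg
  refine ⟨C + C', ?_⟩
  filter_upwards [H, H'] with x h1 h2
  rw [mul_add]
  exact (abs_add_le _ _).trans (add_le_add h1 h2)

theorem Small.neg {f : M → ℝ} (hf : Small τ f) : Small τ (fun x => - f x) := by
  obtain ⟨C, H⟩ := hf
  refine ⟨C, ?_⟩
  filter_upwards [H] with x h1
  rwa [mul_neg, abs_neg]

theorem Small.congr {f g : M → ℝ} (hf : Small τ f) (h : ∀ᶠ x in cocompact M, g x = f x) :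
    Small τ g := by
  obtain ⟨C, H⟩ := hf
  refine ⟨C, ?_⟩
  filter_upwards [H, h] with x h1 h2
  rwa [h2]

theorem Small.zero : Small τ (fun _ => 0) := ⟨0, by simp⟩

end Growth

/-! ### Growth estimates for transport equations -/

section Transport

variable {n : ℕ} {M : Type*} [TopologicalSpace M] [ChartedSpace (Model n) M]
  {τ : SmoothFun n M}

theorem exists_bound_on_level (hτ : Tendsto τ (cocompact M) atTop) (a : ℝ) {F : M → ℝ}
    (hF : ∀ x, τ x = a → ContinuousAt F x) : ∃ B, ∀ x, τ x = a → F x ≤ B := by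
  have hK := isCompact_preimage_Icc hτ a a
  rw [Icc_self] at hK
  obtain ⟨B, hB⟩ := (hK.image_of_continuousOn
    (fun x hx => (hF x hx).continuousWithinAt)).bddAbove
  exact ⟨B, fun x hx => hB (mem_image_of_mem F hx)⟩

variable [IsManifold (𝓡 n) ∞ M] [T2Space M]

/-- An invariant function takes no larger values than on one compact level. The maximum principle
needs a strictly negative derivative, so it is applied to u² - δ τ, and δ is then made small. -/
theorem boundedInf_of_fieldDeriv_eq_zero (hτ : Tendsto τ (cocompact M) atTop)
    {T : SmoothField n M} (hT : ∀ᶠ x in cocompact M, fieldDeriv T τ x = 1)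
    {u : SmoothFun n M} (hu : EqInf (fieldDeriv T u) 0) : BoundedInf u := by
  obtain ⟨a, -, ha⟩ := exists_forall_le_of_eventually (τ := τ) (hT.and hu) 0
  obtain ⟨B, hB⟩ := exists_bound_on_level hτ a (F := u * u)
    (fun x _ => (u * u).contMDiff.continuous.continuousAt)
  have key : ∀ x, a ≤ τ x → u x * u x ≤ B := by
    intro x hx
    refine le_of_forall_pos_le_add fun ε hε => ?_
    -- Chosen so that δ (τ x - a) ≤ ε; the summand 1 keeps the denominator positive when τ x = a.
    set δ := ε / (τ x - a + 1) with hδ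
    have hpos : 0 < τ x - a + 1 := by linarith
    have hδ0 : 0 < δ := div_pos hε hpos
    have h := transport_max_principle hτ T (a := a) (B := B - δ * a)
      (u * u + (-δ) • τ : SmoothFun n M)
      (fun y _ => SmoothFun.mdifferentiableAt _ y) (fun y hy => (ha y hy).1)
      (fun y hy _ => by
        change fieldDeriv T (u * u + (-δ) • τ) y < 0
        rw [map_add, map_smul, fieldDeriv_mul]
        simp only [SmoothFun.add_apply, SmoothFun.mul_apply, SmoothFun.smul_apply,
          (ha y hy).1, (ha y hy).2, SmoothFun.zero_apply]
        linarith)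
      (fun y hy => by
        have : u y * u y ≤ B := hB y hy
        simp only [SmoothFun.add_apply, SmoothFun.mul_apply, SmoothFun.smul_apply, hy]
        linarith) hx
    simp only [SmoothFun.add_apply, SmoothFun.mul_apply, SmoothFun.smul_apply] at h
    have h2 : δ * (τ x - a) ≤ ε := by
      rw [hδ, div_mul_eq_mul_div, div_le_iff₀ hpos]
      nlinarith
    linarith
  refine ⟨1 + B, ?_⟩
  filter_upwards [hτ.eventually_ge_atTop a] with x hx
  have h1 := key x hx
  rw [abs_le]
  constructor <;> nlinarith [sq_nonneg (u x - 1), sq_nonneg (u x + 1)]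

theorem exists_common_bound {ι : Type*} [Finite ι] {P : ι → ℝ → Prop}
    (h : ∀ i, ∃ C₀ : ℝ, ∀ C ≥ C₀, P i C) : ∃ C, 0 ≤ C ∧ ∀ i, P i C := by
  choose C hC using h
  obtain ⟨B, hB⟩ := (Set.finite_range C).bddAbove
  exact ⟨max 0 B, le_max_left _ _, fun i => hC i _ ((hB ⟨i, rfl⟩).trans (le_max_right _ _))⟩

/-- The left side is t times the derivative of ∑ g_a² along the transport field. The factor t is
absorbed by c in the quadratic terms and left with r in the others, and each product is split by 2xy
≤ x² + y². -/
theorem transport_estimate {ι : Type*} [Fintype ι] (g r : ι → ℝ) (c : ι → ι → ℝ) {t C R : ℝ}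
    (hc : ∀ a b, |t * c a b| ≤ C) (hr : ∀ a, |r a| ≤ R) :
    t * ∑ a, 2 * (g a * (∑ b, c a b * g b + r a)) ≤
      (2 * Fintype.card ι * C + 1) * ∑ a, g a * g a + Fintype.card ι * (t * R) ^ 2 := by
  have h1 : ∀ a b, t * (2 * (g a * (c a b * g b))) ≤ C * (g a * g a) + C * (g b * g b) := by
    intro a b
    have hC : 0 ≤ C := (abs_nonneg _).trans (hc a b)
    have h2 : t * (2 * (g a * (c a b * g b))) = (t * c a b) * (2 * (g a * g b)) := by ring
    have h3 : |2 * (g a * g b)| ≤ g a * g a + g b * g b := by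
      rw [abs_le]
      constructor <;> nlinarith [sq_nonneg (g a - g b), sq_nonneg (g a + g b)]
    rw [h2, ← mul_add]
    exact (le_abs_self _).trans (abs_mul (t * c a b) _ ▸
      mul_le_mul (hc a b) h3 (abs_nonneg _) hC)
  have h2 : ∀ a, t * (2 * (g a * r a)) ≤ g a * g a + (t * R) ^ 2 := by
    intro a
    have h3 : (r a) ^ 2 ≤ R ^ 2 := sq_le_sq' (by linarith [(abs_le.1 (hr a)).1]) (abs_le.1 (hr a)).2
    nlinarith [sq_nonneg (g a - t * r a), mul_le_mul_of_nonneg_left h3 (sq_nonneg t)]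
  calc t * ∑ a, 2 * (g a * (∑ b, c a b * g b + r a))
      = ∑ a, (∑ b, t * (2 * (g a * (c a b * g b))) + t * (2 * (g a * r a))) := by
        rw [Finset.mul_sum]
        refine Finset.sum_congr rfl fun a _ => ?_
        simp only [mul_add, Finset.mul_sum]
    _ ≤ ∑ a, (∑ b, (C * (g a * g a) + C * (g b * g b)) + (g a * g a + (t * R) ^ 2)) :=
        Finset.sum_le_sum fun a _ => add_le_add (Finset.sum_le_sum fun b _ => h1 a b) (h2 a)
    _ = _ := by
        simp only [Finset.sum_add_distrib, Finset.sum_const, Finset.card_univ, nsmul_eq_mul,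
          ← Finset.mul_sum]
        ring

/-- Solutions of a linear transport equation with coefficients `O(1 / τ)` and polynomially growing
inhomogeneity grow polynomially. -/
theorem growth_of_transport {ι : Type*} [Fintype ι] (hτ : Tendsto τ (cocompact M) atTop)
    {Y : SmoothField n M} (hY : ∀ᶠ x in cocompact M, fieldDeriv Y τ x = 1)
    {g r : ι → SmoothFun n M} {c : ι → ι → SmoothFun n M}
    (hc : ∀ a b, Small τ (c a b)) (hr : ∀ a, Growth τ (r a))
    (heq : ∀ a, EqInf (fieldDeriv Y (g a)) (∑ b, c a b * g b + r a)) (a : ι) :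
    Growth τ (g a) := by
  obtain ⟨C, hC0, hC⟩ := exists_common_bound (ι := ι × ι)
    (P := fun i C => ∀ᶠ x in cocompact M, |τ x * c i.1 i.2 x| ≤ C) (fun i => by
      obtain ⟨C₀, h⟩ := hc i.1 i.2
      exact ⟨C₀, fun C hC => h.mono fun x hx => hx.trans hC⟩)
  choose N₀ C₀ hN using fun a => (hr a).exists_ge hτ
  obtain ⟨N, hNle⟩ : ∃ N, ∀ a, N₀ a ≤ N :=
    ⟨Finset.univ.sup N₀, fun a => Finset.le_sup (Finset.mem_univ a)⟩
  obtain ⟨R, hR0, hR⟩ := exists_common_bound (ι := ι)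
    (P := fun a C => ∀ᶠ x in cocompact M, |r a x| ≤ C * τ x ^ N)
    (fun a => ⟨C₀ a, fun C hC => hN a N (hNle a) C hC⟩)
  set m : ℝ := (Fintype.card ι : ℝ) with hm
  have hm0 : 0 ≤ m := Nat.cast_nonneg _
  -- A single constant dominating both the coefficient 2mC + 1 of Q and the coefficient mR² of τ^(2N
  -- + 2) in `transport_estimate`.
  set A : ℝ := 2 * m * C + 1 + m * R ^ 2 with hA
  have hA0 : 0 ≤ A := by positivity
  obtain ⟨q, hq1, hq2⟩ : ∃ q : ℕ, A + 1 ≤ q ∧ 2 * N + 2 ≤ q := by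
    obtain ⟨q, hq⟩ := exists_nat_ge (A + 1)
    exact ⟨max q (2 * N + 2), hq.trans (by exact_mod_cast le_max_left _ _), le_max_right _ _⟩
  set Q : SmoothFun n M := ∑ a, g a * g a with hQ
  have hQx (x : M) : Q x = ∑ a, g a x * g a x := by
    rw [hQ, SmoothFun.sum_apply]
    rfl
  have hQ0 (x : M) : 0 ≤ Q x := by
    rw [hQx]
    exact Finset.sum_nonneg fun a _ => mul_self_nonneg _
  have hYQ : ∀ᶠ x in cocompact M, τ x * fieldDeriv Y Q x ≤ A * Q x + A * τ x ^ (2 * N + 2) := by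
    filter_upwards [eventually_all.2 hC, eventually_all.2 hR, eventually_all.2 heq,
      hτ.eventually_ge_atTop 1] with x h1 h2 h3 h4
    have h5 := transport_estimate (fun a => g a x) (fun a => r a x) (fun a b => c a b x)
      (fun a b => h1 (a, b)) h2
    have h6 : fieldDeriv Y Q x = ∑ a, 2 * (g a x * (∑ b, c a b x * g b x + r a x)) := by
      rw [hQ, map_sum, SmoothFun.sum_apply]
      refine Finset.sum_congr rfl fun a _ => ?_
      rw [fieldDeriv_mul, SmoothFun.add_apply, SmoothFun.mul_apply, SmoothFun.mul_apply, h3 a,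
        SmoothFun.add_apply, SmoothFun.sum_apply]
      simp only [SmoothFun.mul_apply]
      ring
    rw [h6]
    refine h5.trans ?_
    rw [← hQx]
    have h7 : (τ x * (R * τ x ^ N)) ^ 2 = R ^ 2 * τ x ^ (2 * N + 2) := by ring
    rw [h7]
    have h8 : 0 ≤ τ x ^ (2 * N + 2) := by positivity
    have h9 : (2 * m * C + 1) * Q x ≤ A * Q x :=
      mul_le_mul_of_nonneg_right (by rw [hA]; nlinarith [mul_nonneg hm0 (sq_nonneg R)]) (hQ0 x)
    have h10 : m * R ^ 2 * τ x ^ (2 * N + 2) ≤ A * τ x ^ (2 * N + 2) :=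
      mul_le_mul_of_nonneg_right (by rw [hA]; nlinarith [mul_nonneg hm0 hC0]) h8
    linarith
  obtain ⟨a₀, ha1, ha⟩ := exists_forall_le_of_eventually (τ := τ) (hY.and hYQ) 1
  set F : M → ℝ := fun x => Q x * (τ x ^ q)⁻¹ with hF
  have hτd : ∀ x, a₀ ≤ τ x → 0 < τ x ^ q := fun x hx => by
    have : 0 < τ x := by linarith
    positivity
  have hFd : ∀ x, a₀ ≤ τ x → MDifferentiableAt (𝓡 n) 𝓘(ℝ, ℝ) F x := by
    intro x hx
    have h1 : ContMDiffAt (𝓡 n) 𝓘(ℝ, ℝ) ∞ (fun y => ((τ ^ q : SmoothFun n M) y)⁻¹) x :=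
      ContMDiffAt.inv₀ (τ ^ q : SmoothFun n M).contMDiff.contMDiffAt
        (by rw [SmoothFun.pow_apply]; exact (hτd x hx).ne')
    have h2 : ContMDiffAt (𝓡 n) 𝓘(ℝ, ℝ) ∞ F x := by
      simpa only [hF, SmoothFun.pow_apply] using! Q.contMDiff.contMDiffAt.mul h1
    exact h2.mdifferentiableAt (by simp)
  obtain ⟨B, hB⟩ := exists_bound_on_level hτ a₀ (F := F)
    (fun x hx => (hFd x hx.ge).continuousAt)
  -- With q ≥ 2N + 2, τ · τ^q · Y(F) ≤ (A - q) F τ^q + A τ^q. Since q ≥ A + 1, the right side is at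
  -- most (A - F) τ^q, which is negative as soon as F > A.
  have hmax : ∀ x, a₀ ≤ τ x → F x ≤ max A B := by
    intro x hx
    refine transport_max_principle hτ Y F hFd (fun y hy => (ha y hy).1) (fun y hy hAB => ?_)
      (fun y hy => (hB y hy).trans (le_max_right _ _)) hx
    have hτ1 : 1 ≤ τ y := ha1.trans hy
    have hpos := hτd y hy
    have hprod : (F * (τ ^ q : SmoothFun n M) : M → ℝ) =ᶠ[𝓝 y] Q := by
      have : ∀ᶠ z in 𝓝 y, 0 < τ z :=
        τ.contMDiff.continuous.continuousAt.eventually_const_lt (by linarith)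
      filter_upwards [this] with z hz
      rw [Pi.mul_apply, SmoothFun.pow_apply, hF]
      exact inv_mul_cancel_right₀ (by positivity) _
    have h1 : mvfderiv (𝓡 n) Q y = _ :=
      (hprod.mfderiv_eq).symm.trans (mvfderiv_mul (hFd y hy)
        ((τ ^ q : SmoothFun n M).mdifferentiableAt y))
    have h2 : fieldDeriv Y Q y = F y * fieldDeriv Y (τ ^ q) y +
        (τ y ^ q) * mvfderiv (𝓡 n) F y (Y y) := by
      rw [fieldDeriv_apply, h1]
      simp [fieldDeriv_apply, SmoothFun.pow_apply]
    rw [fieldDeriv_pow, (ha y hy).1, mul_one] at h2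
    have h3 := (ha y hy).2
    have hQF : Q y = F y * τ y ^ q := by
      rw [hF]
      exact (inv_mul_cancel_right₀ hpos.ne' _).symm
    have hq0 : q ≠ 0 := by omega
    have hpow : τ y * τ y ^ (q - 1) = τ y ^ q := mul_pow_sub_one hq0 _
    rw [h2, hQF] at h3
    have hpow2 : τ y ^ (2 * N + 2) ≤ τ y ^ q := pow_le_pow_right₀ hτ1 hq2
    have hAF : A < F y := (le_max_left _ _).trans_lt hAB
    have h4 : τ y * (τ y ^ q * mvfderiv (𝓡 n) F y (Y y)) ≤
        (A - q) * (F y * τ y ^ q) + A * τ y ^ q := by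
      have e1 : τ y * (F y * (q * τ y ^ (q - 1))) = q * (F y * τ y ^ q) := by
        rw [← hpow]; ring
      have e2 := mul_le_mul_of_nonneg_left hpow2 hA0
      rw [mul_add, e1] at h3
      linarith
    have hF0 : 0 ≤ F y := hA0.trans hAF.le
    have h5 : (A - q) * (F y * τ y ^ q) + A * τ y ^ q < 0 := by
      have e3 : (A - q) * (F y * τ y ^ q) ≤ (-1) * (F y * τ y ^ q) :=
        mul_le_mul_of_nonneg_right (by linarith) (by positivity)
      have e4 : A * τ y ^ q < F y * τ y ^ q := mul_lt_mul_of_pos_right hAF hpos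
      linarith
    have h6 : (τ y * τ y ^ q) * mvfderiv (𝓡 n) F y (Y y) < 0 := by
      rw [mul_assoc]
      exact h4.trans_lt h5
    exact (pos_iff_neg_of_mul_neg h6).1 (by positivity)
  refine ⟨q, 1 + max A B, ?_⟩
  filter_upwards [hτ.eventually_ge_atTop a₀] with x hx
  have hpos := hτd x hx
  have h1 : Q x ≤ max A B * τ x ^ q := by
    have h2 := mul_le_mul_of_nonneg_right (hmax x hx) hpos.le
    rwa [hF, inv_mul_cancel_right₀ hpos.ne'] at h2
  have h2 : g a x * g a x ≤ Q x := by
    rw [hQx]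
    exact Finset.single_le_sum (f := fun a => g a x * g a x)
      (fun b _ => mul_self_nonneg _) (Finset.mem_univ a)
  have h3 : 1 ≤ τ x ^ q := one_le_pow₀ (ha1.trans hx)
  rw [add_mul, one_mul, abs_le]
  constructor <;> nlinarith [sq_nonneg (g a x - 1), sq_nonneg (g a x + 1)]

end Transport

/-! ### The ring of functions with polynomially growing derivatives -/

section PolyOrder

variable {n : ℕ} {M : Type*} [TopologicalSpace M] [ChartedSpace (Model n) M]
  [IsManifold (𝓡 n) ∞ M]

/-- The iterated derivatives of `f` of order at most `k` along constant fields grow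
polynomially. -/
def PolyOrder (τ : M → ℝ) (T : SmoothField n M) : ℕ → SmoothFun n M → Prop
  | 0, f => Growth τ f
  | k + 1, f => Growth τ f ∧ ∀ X, IsConstantField T X → PolyOrder τ T k (fieldDeriv X f)

/-- All iterated derivatives of `f` along constant fields grow polynomially. -/
def PolyFun (τ : M → ℝ) (T : SmoothField n M) (f : SmoothFun n M) : Prop :=
  ∀ k, PolyOrder τ T k f

variable {τ : M → ℝ} {T : SmoothField n M}

theorem PolyOrder.growth {k : ℕ} {f : SmoothFun n M} (h : PolyOrder τ T k f) : Growth τ f := by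
  cases k with
  | zero => exact h
  | succ k => exact h.1

theorem PolyOrder.of_succ {k : ℕ} :
    ∀ {f : SmoothFun n M}, PolyOrder τ T (k + 1) f → PolyOrder τ T k f := by
  induction k with
  | zero => exact fun h => h.1
  | succ k ih => exact fun h => ⟨h.1, fun X hX => ih (h.2 X hX)⟩

theorem PolyFun.fieldDeriv {f : SmoothFun n M} (h : PolyFun τ T f) {X : SmoothField n M}
    (hX : IsConstantField T X) : PolyFun τ T (fieldDeriv X f) := fun k => (h (k + 1)).2 X hX

theorem PolyOrder.congr [T2Space M] {k : ℕ} : ∀ {f g : SmoothFun n M}, PolyOrder τ T k f →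
    EqInf g f → PolyOrder τ T k g := by
  induction k with
  | zero => exact fun h e => Growth.congr h e
  | succ k ih => exact fun h e => ⟨h.1.congr e, fun X hX => ih (h.2 X hX) (e.fieldDeriv X)⟩

theorem PolyFun.congr [T2Space M] {f g : SmoothFun n M} (h : PolyFun τ T f) (e : EqInf g f) :
    PolyFun τ T g := fun k => (h k).congr e

theorem PolyOrder.add (hτ : Tendsto τ (cocompact M) atTop) {k : ℕ} :
    ∀ {f g : SmoothFun n M}, PolyOrder τ T k f → PolyOrder τ T k g → PolyOrder τ T k (f + g) := by
  induction k with
  | zero => exact fun hf hg => Growth.add hτ hf hg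
  | succ k ih =>
    intro f g hf hg
    refine ⟨Growth.add hτ hf.1 hg.1, fun X hX => ?_⟩
    rw [map_add]
    exact ih (hf.2 X hX) (hg.2 X hX)

theorem PolyOrder.mul (hτ : Tendsto τ (cocompact M) atTop) {k : ℕ} :
    ∀ {f g : SmoothFun n M}, PolyOrder τ T k f → PolyOrder τ T k g → PolyOrder τ T k (f * g) := by
  induction k with
  | zero => exact fun hf hg => Growth.mul hf hg
  | succ k ih =>
    intro f g hf hg
    refine ⟨Growth.mul hf.1 hg.1, fun X hX => ?_⟩
    rw [fieldDeriv_mul]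
    exact PolyOrder.add hτ (ih (hf.2 X hX) hg.of_succ) (ih hf.of_succ (hg.2 X hX))

theorem polyFun_of_eventually_const [T2Space M] {f : SmoothFun n M} {c : ℝ}
    (h : ∀ᶠ x in cocompact M, f x = c) : PolyFun τ T f := by
  intro k
  have hg {f : SmoothFun n M} {c : ℝ} (h : ∀ᶠ x in cocompact M, f x = c) : Growth τ f :=
    BoundedInf.growth ⟨|c|, h.mono fun x hx => by rw [hx]⟩
  induction k generalizing f c with
  | zero => exact hg h
  | succ k ih => exact ⟨hg h, fun X _ => ih (c := 0) (fieldDeriv_of_eventually_const h X)⟩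

theorem PolyOrder.sum [T2Space M] (hτ : Tendsto τ (cocompact M) atTop) {k : ℕ} {ι : Type*}
    (s : Finset ι) {f : ι → SmoothFun n M} (h : ∀ i ∈ s, PolyOrder τ T k (f i)) :
    PolyOrder τ T k (∑ i ∈ s, f i) :=
  Finset.sum_induction f _ (fun _ _ hf hg => hf.add hτ hg)
    (polyFun_of_eventually_const (c := 0) (Eventually.of_forall fun _ => rfl) k) h

theorem PolyFun.add (hτ : Tendsto τ (cocompact M) atTop) {f g : SmoothFun n M}
    (hf : PolyFun τ T f) (hg : PolyFun τ T g) : PolyFun τ T (f + g) :=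
  fun k => (hf k).add hτ (hg k)

theorem PolyFun.mul (hτ : Tendsto τ (cocompact M) atTop) {f g : SmoothFun n M}
    (hf : PolyFun τ T f) (hg : PolyFun τ T g) : PolyFun τ T (f * g) :=
  fun k => (hf k).mul hτ (hg k)

theorem PolyFun.sub [T2Space M] (hτ : Tendsto τ (cocompact M) atTop) {f g : SmoothFun n M}
    (hf : PolyFun τ T f) (hg : PolyFun τ T g) : PolyFun τ T (f - g) := by
  have h1 : PolyFun τ T (-1 : SmoothFun n M) :=
    polyFun_of_eventually_const (c := -1) (Eventually.of_forall fun _ => rfl)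
  rw [sub_eq_add_neg, ← neg_one_mul]
  exact hf.add hτ (h1.mul hτ hg)

theorem PolyFun.sum [T2Space M] (hτ : Tendsto τ (cocompact M) atTop) {ι : Type*}
    (s : Finset ι) {f : ι → SmoothFun n M} (h : ∀ i ∈ s, PolyFun τ T (f i)) :
    PolyFun τ T (∑ i ∈ s, f i) :=
  fun k => PolyOrder.sum hτ s fun i hi => h i hi k

theorem PolyFun.prod [T2Space M] (hτ : Tendsto τ (cocompact M) atTop) {ι : Type*}
    (s : Finset ι) {f : ι → SmoothFun n M} (h : ∀ i ∈ s, PolyFun τ T (f i)) :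
    PolyFun τ T (∏ i ∈ s, f i) :=
  Finset.prod_induction f _ (fun _ _ hf hg => hf.mul hτ hg)
    (polyFun_of_eventually_const (c := 1) (Eventually.of_forall fun _ => rfl)) h

theorem PolyFun.of_forall_constOperators {f : SmoothFun n M}
    (h : ∀ D ∈ constOperators T, Growth τ (D f)) : PolyFun τ T f := by
  intro k
  induction k generalizing f with
  | zero => exact h 1 (one_mem _)
  | succ k ih =>
    refine ⟨h 1 (one_mem _), fun X hX => ih fun D hD => ?_⟩
    exact h (D * CylEnd.fieldDeriv X) (mul_mem hD (Algebra.subset_adjoin ⟨X, hX, rfl⟩))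

/-- Together with `PolyFun.of_forall_constOperators`, this replaces the operator algebra by iterated
derivatives, on which induction on the order is possible. -/
theorem PolyFun.constOperators [T2Space M] (hτ : Tendsto τ (cocompact M) atTop)
    {D : Module.End ℝ (SmoothFun n M)} (hD : D ∈ constOperators T) :
    ∀ f : SmoothFun n M, PolyFun τ T f → PolyFun τ T (D f) := by
  induction hD using Algebra.adjoin_induction with
  | mem D hD =>
    obtain ⟨X, hX, rfl⟩ := hD
    exact fun f hf => hf.fieldDeriv hX
  | algebraMap c =>
    intro f hf
    have h1 : PolyFun τ T (algebraMap ℝ (SmoothFun n M) c) :=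
      polyFun_of_eventually_const (c := c) (Eventually.of_forall fun _ => rfl)
    have h2 : (algebraMap ℝ (Module.End ℝ (SmoothFun n M)) c) f =
        algebraMap ℝ (SmoothFun n M) c * f := by
      rw [Module.algebraMap_end_apply, Algebra.smul_def]
    rw [h2]
    exact h1.mul hτ hf
  | add D D' _ _ hD hD' => exact fun f hf => (hD f hf).add hτ (hD' f hf)
  | mul D D' _ _ hD hD' => exact fun f hf => hD _ (hD' f hf)

theorem hasPolynomialGrowth_iff [T2Space M] {t : M → ℝ} (hτ : Tendsto τ (cocompact M) atTop)
    (ht : ∀ᶠ x in cocompact M, t x = τ x) {f : M → ℝ} :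
    HasPolynomialGrowth t T f ↔
      ∃ hf : ContMDiff (𝓡 n) 𝓘(ℝ, ℝ) ∞ f, PolyFun τ T (⟨f, hf⟩ : SmoothFun n M) := by
  refine exists_congr fun hf => ⟨fun h => PolyFun.of_forall_constOperators fun D hD => ?_,
    fun h D hD => ?_⟩
  · obtain ⟨N, C, -, -, hK⟩ := h D hD
    refine ⟨N, C, ?_⟩
    filter_upwards [eventually_cocompact_iff.2 hK, ht] with x h1 h2
    rwa [← h2]
  · obtain ⟨N₀, C₀, hN⟩ := ((PolyFun.constOperators hτ hD _ h) 0).growth.exists_ge hτ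
    refine ⟨max N₀ 1, max C₀ 1, by simp, by simp, eventually_cocompact_iff.1 ?_⟩
    filter_upwards [hN _ (le_max_left _ _) _ (le_max_left _ _), ht] with x h1 h2
    rwa [h2]

theorem IsBoundedWithDerivatives.polyFun {f : SmoothFun n M}
    (h : IsBoundedWithDerivatives T f) : PolyFun τ T f :=
  PolyFun.of_forall_constOperators fun D hD => by
    obtain ⟨B, hB⟩ := h D hD
    exact BoundedInf.growth ⟨B, Eventually.of_forall hB⟩

end PolyOrder

/-! ### Invariant frames and invariant functions -/

section Frame

variable {n : ℕ} {M : Type*} [TopologicalSpace M] [ChartedSpace (Model n) M]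
  [IsManifold (𝓡 n) ∞ M]

/-- Functions `f` with constant derivative along `T` and constant vector fields `X` for `T`, such
that `∑ df_i ⊗ X_i` is the identity; all this off a compact set. -/
structure IsInvariantFrame {ι : Type*} [Fintype ι] (T : SmoothField n M)
    (f : ι → SmoothFun n M) (X : ι → SmoothField n M) : Prop where
  const (i : ι) : IsConstantField T (X i)
  deriv (i : ι) : ∃ c : ℝ, ∀ᶠ x in cocompact M, fieldDeriv T (f i) x = c
  sum_eq : ∀ᶠ x in cocompact M, ∀ v : TangentSpace (𝓡 n) x,
    ∑ i, mvfderiv (𝓡 n) (f i) x v • X i x = v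

variable {ι : Type*} [Fintype ι] {T : SmoothField n M} {f : ι → SmoothFun n M}
  {X : ι → SmoothField n M}

theorem IsInvariantFrame.fieldDeriv_eq (h : IsInvariantFrame T f X) (Z : SmoothField n M)
    (u : SmoothFun n M) :
    EqInf (fieldDeriv Z u) (∑ i, fieldDeriv Z (f i) * fieldDeriv (X i) u) := by
  filter_upwards [h.sum_eq] with x hx
  rw [SmoothFun.sum_apply, fieldDeriv_apply, ← hx (Z x), map_sum]
  refine Finset.sum_congr rfl fun i _ => ?_
  rw [map_smul]
  rfl

theorem IsInvariantFrame.bracketDeriv_eq (h : IsInvariantFrame T f X) (Z W : SmoothField n M)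
    (u : SmoothFun n M) :
    EqInf (bracketDeriv Z W u) (∑ i, bracketDeriv Z W (f i) * fieldDeriv (X i) u) := by
  filter_upwards [h.sum_eq] with x hx
  rw [SmoothFun.sum_apply, bracketDeriv_apply,
    ← hx (VectorField.mlieBracket (𝓡 n) Z W x), map_sum]
  refine Finset.sum_congr rfl fun i _ => ?_
  rw [map_smul, SmoothFun.mul_apply, bracketDeriv_apply]
  rfl

variable [T2Space M] {τ : SmoothFun n M}

/-- `u` is invariant under `T` off a compact set. -/
def IsInvariantFun (T : SmoothField n M) (u : SmoothFun n M) : Prop := EqInf (fieldDeriv T u) 0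

theorem IsInvariantFun.fieldDeriv {u : SmoothFun n M} (hu : IsInvariantFun T u)
    {Z : SmoothField n M} (hZ : IsConstantField T Z) : IsInvariantFun T (fieldDeriv Z u) :=
  (hZ.comm u).symm.trans (fieldDeriv_of_eventually_const (c := 0) hu Z)

theorem isInvariantFun_fieldDeriv {u : SmoothFun n M} {c : ℝ}
    (hu : ∀ᶠ x in cocompact M, fieldDeriv T u x = c)
    {Z : SmoothField n M} (hZ : IsConstantField T Z) : IsInvariantFun T (fieldDeriv Z u) :=
  (hZ.comm u).symm.trans (fieldDeriv_of_eventually_const hu Z)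

/-- Constant fields commute with T and so preserve invariance: every iterated derivative is again
invariant, hence bounded at infinity. -/
theorem IsInvariantFun.polyFun (hτ : Tendsto τ (cocompact M) atTop)
    (hT : ∀ᶠ x in cocompact M, CylEnd.fieldDeriv T τ x = 1) {u : SmoothFun n M}
    (hu : IsInvariantFun T u) : PolyFun τ T u := by
  intro k
  induction k generalizing u with
  | zero => exact (boundedInf_of_fieldDeriv_eq_zero hτ hT hu).growth
  | succ k ih =>
    exact ⟨(boundedInf_of_fieldDeriv_eq_zero hτ hT hu).growth, fun X hX => ih (hu.fieldDeriv hX)⟩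

/-- The coefficients Z(f_i) of a constant field are invariant, so derivatives along the finitely
many X_i control those along all constant fields. -/
theorem IsInvariantFrame.polyOrder_fieldDeriv (h : IsInvariantFrame T f X)
    (hτ : Tendsto τ (cocompact M) atTop)
    (hT : ∀ᶠ x in cocompact M, fieldDeriv T τ x = 1) {k : ℕ} {u : SmoothFun n M}
    (hu : ∀ i, PolyOrder τ T k (fieldDeriv (X i) u)) {Z : SmoothField n M}
    (hZ : IsConstantField T Z) : PolyOrder τ T k (fieldDeriv Z u) := by
  refine PolyOrder.congr (PolyOrder.sum hτ Finset.univ fun i _ => ?_) (h.fieldDeriv_eq Z u)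
  obtain ⟨c, hc⟩ := h.deriv i
  exact ((isInvariantFun_fieldDeriv hc hZ).polyFun hτ hT k).mul hτ (hu i)

end Frame

/-! ### The transport systems of the perturbed field -/

section Perturbation

variable {n : ℕ} {M : Type*} [TopologicalSpace M] [ChartedSpace (Model n) M]
  [IsManifold (𝓡 n) ∞ M] [T2Space M]

/-- The product of a smooth function and a smooth vector field. -/
def smulField (u : SmoothFun n M) (X : SmoothField n M) : SmoothField n M :=
  ⟨(u : M → ℝ) • (X : Π x : M, TangentSpace (𝓡 n) x), u.contMDiff.smul_section X.contMDiff⟩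

omit [T2Space M] in
theorem fieldDeriv_smulField (u : SmoothFun n M) (X : SmoothField n M) (f : SmoothFun n M) :
    fieldDeriv (smulField u X) f = u * fieldDeriv X f := by
  ext x
  exact map_smul (mvfderiv (𝓡 n) f x) (u x) (X x)

theorem isConstantField_of_forall_bracketDeriv {T X : SmoothField n M}
    (h : ∀ᶠ x in cocompact M, ∀ f, bracketDeriv X T f x = 0) : IsConstantField T X := by
  refine eventually_cocompact_iff.1 (h.mono fun x hx => ?_)
  refine eq_zero_of_forall_mvfderiv_eq_zero _ fun f => ?_
  rw [← bracketDeriv_apply, hx]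

/-- [uT, T] = -T(u) T. These constant fields are test fields for the bracket hypothesis. -/
theorem isConstantField_smulField {T : SmoothField n M} {u : SmoothFun n M}
    (hu : IsInvariantFun T u) : IsConstantField T (smulField u T) := by
  refine isConstantField_of_forall_bracketDeriv ?_
  filter_upwards [hu] with x hx f
  rw [bracketDeriv, fieldDeriv_smulField, fieldDeriv_smulField, fieldDeriv_mul,
    sub_add_cancel_right, SmoothFun.neg_apply, SmoothFun.mul_apply, hx, SmoothFun.zero_apply, zero_mul, neg_zero]

/-- The field `T + Yp` is an admissible perturbation of the cylindrical structure `(τ, T)`. -/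
structure IsPerturbation (τ : SmoothFun n M) (T Yp : SmoothField n M) : Prop where
  tendsto : Tendsto τ (cocompact M) atTop
  deriv_eq_one : ∀ᶠ x in cocompact M, fieldDeriv T τ x = 1
  perp : EqInf (fieldDeriv Yp τ) 0
  strong : IsStronglyBounded T (fun x => Yp x)
  weak (X : SmoothField n M) : IsConstantField T X →
    ∃ (m : ℕ) (φ : Fin m → M → ℝ) (Z : Fin m → SmoothField n M),
      (∀ i, IsConstantField T (Z i)) ∧ (∀ i, BoundedInf (φ i)) ∧ ∀ᶠ x in cocompact M,
        τ x • VectorField.mlieBracket (𝓡 n) X Yp x = ∑ i, φ i x • Z i x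

namespace IsPerturbation

variable {τ : SmoothFun n M} {T Yp : SmoothField n M}

omit [T2Space M] in
theorem deriv_add_eq_one (H : IsPerturbation τ T Yp) :
    ∀ᶠ x in cocompact M, fieldDeriv (T + Yp) τ x = 1 := by
  filter_upwards [H.deriv_eq_one, H.perp] with x h1 h2
  rw [fieldDeriv_add_field, SmoothFun.add_apply, h1, h2, SmoothFun.zero_apply, add_zero]

/-- τ [X, Y_⊥] u is a combination, with bounded coefficients, of derivatives Z_i(u) along constant
fields; these are T-invariant and hence bounded. -/
theorem small_bracketDeriv (H : IsPerturbation τ T Yp) {X : SmoothField n M}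
    (hX : IsConstantField T X) {u : SmoothFun n M} {c : ℝ}
    (hu : ∀ᶠ x in cocompact M, fieldDeriv T u x = c) : Small τ (bracketDeriv X Yp u) := by
  obtain ⟨m, φ, Z, hZ, hφ, hsum⟩ := H.weak X hX
  choose C hC using hφ
  choose D hD using fun i => boundedInf_of_fieldDeriv_eq_zero H.tendsto H.deriv_eq_one
    (isInvariantFun_fieldDeriv hu (hZ i))
  refine ⟨∑ i, C i * D i, ?_⟩
  filter_upwards [hsum, eventually_all.2 hC, eventually_all.2 hD] with x h1 h2 h3
  rw [bracketDeriv_apply, ← smul_eq_mul, ← map_smul, h1, map_sum]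
  refine (Finset.abs_sum_le_sum_abs _ _).trans (Finset.sum_le_sum fun i _ => ?_)
  rw [map_smul, smul_eq_mul, abs_mul]
  exact mul_le_mul (h2 i) (h3 i) (abs_nonneg _) ((abs_nonneg _).trans (h2 i))

/-- Apply the bracket hypothesis to the constant field uT and test on τ: since T(τ) = 1 and Y_⊥(τ) =
0, [uT, Y_⊥] τ = -Y_⊥(u). -/
theorem small_fieldDeriv (H : IsPerturbation τ T Yp) {u : SmoothFun n M}
    (hu : IsInvariantFun T u) : Small τ (fieldDeriv Yp u) := by
  have h1 := (H.small_bracketDeriv (isConstantField_smulField hu) H.deriv_eq_one).neg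
  refine h1.congr ?_
  have h2 : EqInf (u * fieldDeriv T τ) u := by
    filter_upwards [H.deriv_eq_one] with x hx
    rw [SmoothFun.mul_apply, hx, mul_one]
  filter_upwards [h2.fieldDeriv Yp, EqInf.fieldDeriv H.perp (smulField u T)] with x h3 h4
  rw [bracketDeriv, SmoothFun.sub_apply, h4, fieldDeriv_smulField u T τ, h3,
    map_zero, SmoothFun.zero_apply]
  ring

omit [T2Space M] in
theorem exists_fieldDeriv_eq_sum (H : IsPerturbation τ T Yp) :
    ∃ (m : ℕ) (φ : Fin m → SmoothFun n M) (Z : Fin m → SmoothField n M),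
      (∀ i, IsConstantField T (Z i)) ∧ (∀ i, PolyFun τ T (φ i)) ∧
        ∀ u, fieldDeriv Yp u = ∑ i, φ i * fieldDeriv (Z i) u := by
  obtain ⟨m, φ, Z, hZ, hφ, hsum⟩ := H.strong
  refine ⟨m, φ, Z, hZ, fun i => (hφ i).polyFun, fun u => ?_⟩
  ext x
  rw [SmoothFun.sum_apply, fieldDeriv_apply, show Yp x = _ from hsum x, map_sum]
  refine Finset.sum_congr rfl fun i _ => ?_
  rw [map_smul]
  rfl

theorem polyFun_fieldDeriv (H : IsPerturbation τ T Yp) {u : SmoothFun n M}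
    (hu : PolyFun τ T u) : PolyFun τ T (fieldDeriv Yp u) := by
  obtain ⟨m, φ, Z, hZ, hφ, hsum⟩ := H.exists_fieldDeriv_eq_sum
  rw [hsum]
  exact PolyFun.sum H.tendsto _ fun i _ => (hφ i).mul H.tendsto (hu.fieldDeriv (hZ i))

theorem polyFun_fieldDeriv_of_const (H : IsPerturbation τ T Yp) {u : SmoothFun n M} {c : ℝ}
    (hu : ∀ᶠ x in cocompact M, fieldDeriv T u x = c) : PolyFun τ T (fieldDeriv Yp u) := by
  obtain ⟨m, φ, Z, hZ, hφ, hsum⟩ := H.exists_fieldDeriv_eq_sum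
  rw [hsum]
  exact PolyFun.sum H.tendsto _ fun i _ => (hφ i).mul H.tendsto
    ((isInvariantFun_fieldDeriv hu (hZ i)).polyFun H.tendsto H.deriv_eq_one)

/-- The coefficients in the bracket hypothesis are merely bounded functions and say nothing about
derivatives. These are controlled by the strong boundedness of Y_⊥ instead, without the decay. -/
theorem polyFun_bracketDeriv (H : IsPerturbation τ T Yp) {X : SmoothField n M}
    (hX : IsConstantField T X) {u : SmoothFun n M} {c : ℝ}
    (hu : ∀ᶠ x in cocompact M, fieldDeriv T u x = c) : PolyFun τ T (bracketDeriv X Yp u) :=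
  ((H.polyFun_fieldDeriv_of_const hu).fieldDeriv hX).sub H.tendsto
    (H.polyFun_fieldDeriv ((isInvariantFun_fieldDeriv hu hX).polyFun H.tendsto H.deriv_eq_one))

-- [X, T + Y_⊥] = [X, Y_⊥] at infinity because X commutes with T.
omit [T2Space M] in
theorem fieldDeriv_add_fieldDeriv {X : SmoothField n M} (hX : IsConstantField T X)
    (u : SmoothFun n M) : EqInf (fieldDeriv (T + Yp) (fieldDeriv X u))
      (fieldDeriv X (fieldDeriv (T + Yp) u) - bracketDeriv X Yp u) := by
  filter_upwards [hX.comm u] with x hx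
  simp only [fieldDeriv_add_field, map_add, bracketDeriv, SmoothFun.sub_apply, SmoothFun.add_apply,
    hx]
  ring

variable {κ : Type u} [Fintype κ] {f : κ → SmoothFun n M} {X : κ → SmoothField n M}

/-- Induction on k, over all finite systems at once: differentiating along the frame replaces the
index set ι by ι × κ. Decay is needed only for the matrix itself, polynomial growth for its
derivatives. -/
theorem polyOrder_of_transport (H : IsPerturbation τ T Yp) (hF : IsInvariantFrame T f X) (k : ℕ) :
    ∀ {ι : Type u} [Fintype ι] {g r : ι → SmoothFun n M} {c : ι → ι → SmoothFun n M},
      (∀ a b, Small τ (c a b)) → (∀ a b, PolyFun τ T (c a b)) → (∀ a, PolyOrder τ T k (r a)) →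
      (∀ a, EqInf (fieldDeriv (T + Yp) (g a)) (∑ b, c a b * g b + r a)) →
      ∀ a, PolyOrder τ T k (g a) := by
  classical
  induction k with
  | zero =>
    intro ι _ g r c hc _ hr heq a
    exact growth_of_transport H.tendsto H.deriv_add_eq_one hc hr heq a
  | succ k ih =>
    intro ι _ g r c hc hcp hr heq
    have hg := ih hc hcp (fun a => (hr a).of_succ) heq
    -- Y(X_j g_a) = X_j(Y g_a) - [X_j, Y_⊥] g_a, and the bracket is expanded in the frame. Terms
    -- with X_j(c_ab) g_b go to the inhomogeneity, where g_b is already known to order k; the new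
    -- matrix is c ⊗ 1 minus 1 ⊗ ([X_j, Y_⊥] f_l).
    have key : ∀ p : ι × κ, PolyOrder τ T k (fieldDeriv (X p.2) (g p.1)) := by
      refine ih (ι := ι × κ) (g := fun p => fieldDeriv (X p.2) (g p.1))
        (r := fun p => ∑ b, fieldDeriv (X p.2) (c p.1 b) * g b + fieldDeriv (X p.2) (r p.1))
        (c := fun p q => (if p.2 = q.2 then c p.1 q.1 else 0) -
          (if p.1 = q.1 then bracketDeriv (X p.2) Yp (f q.2) else 0)) ?_ ?_ ?_ ?_
      · rintro ⟨a, j⟩ ⟨b, l⟩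
        obtain ⟨e, he⟩ := hF.deriv l
        have h1 : Small τ (if j = l then c a b else 0 : SmoothFun n M) := by
          split_ifs
          exacts [hc a b, Small.zero]
        have h2 : Small τ (if a = b then bracketDeriv (X j) Yp (f l) else 0 : SmoothFun n M) := by
          split_ifs
          exacts [H.small_bracketDeriv (hF.const j) he, Small.zero]
        exact (h1.add h2.neg).congr (Eventually.of_forall fun x => sub_eq_add_neg _ _)
      · rintro ⟨a, j⟩ ⟨b, l⟩
        obtain ⟨e, he⟩ := hF.deriv l
        have h0 : PolyFun τ T (0 : SmoothFun n M) :=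
          polyFun_of_eventually_const (c := 0) (Eventually.of_forall fun _ => rfl)
        refine PolyFun.sub H.tendsto ?_ ?_
        · dsimp only
          split_ifs
          exacts [hcp a b, h0]
        · dsimp only
          split_ifs
          exacts [H.polyFun_bracketDeriv (hF.const j) he, h0]
      · rintro ⟨a, j⟩
        exact PolyOrder.add H.tendsto (PolyOrder.sum H.tendsto _ fun b _ =>
          (((hcp a b).fieldDeriv (hF.const j)) k).mul H.tendsto (hg b)) ((hr a).2 _ (hF.const j))
      · rintro ⟨a, j⟩
        dsimp only
        filter_upwards [fieldDeriv_add_fieldDeriv (Yp := Yp) (hF.const j) (g a),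
          (heq a).fieldDeriv (X j), hF.bracketDeriv_eq (X j) Yp (g a)] with x h1 h2 h3
        rw [h1, SmoothFun.sub_apply, h2, h3]
        simp only [map_add, map_sum, fieldDeriv_mul, SmoothFun.add_apply, SmoothFun.sum_apply,
          Fintype.sum_prod_type, sub_mul, Finset.sum_sub_distrib, Finset.sum_add_distrib, ite_mul,
          zero_mul, SmoothFun.mul_apply, SmoothFun.sub_apply]
        have hite (p : Prop) [Decidable p] (F : SmoothFun n M) :
            (if p then F else 0) x = if p then F x else 0 := by split_ifs <;> rfl
        rw [Finset.sum_comm (f := fun b i => (if a = b then bracketDeriv (X j) Yp (f i) *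
          fieldDeriv (X i) (g b) else 0 : SmoothFun n M) x)]
        simp only [hite, Finset.sum_ite_eq, Finset.mem_univ, if_true, SmoothFun.mul_apply]
        ring
    intro a
    refine ⟨(hg a).growth, fun Z hZ => ?_⟩
    exact hF.polyOrder_fieldDeriv H.tendsto H.deriv_eq_one (fun j => key (a, j)) hZ

/-- Fields commuting with `T + Yp` have polynomially growing coefficients in a frame invariant
under `T`. -/
theorem polyFun_fieldDeriv_of_isConstantField_add (H : IsPerturbation τ T Yp)
    (hF : IsInvariantFrame T f X) {Z : SmoothField n M} (hZ : IsConstantField (T + Yp) Z) (i : κ) :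
    PolyFun τ T (fieldDeriv Z (f i)) := by
  intro k
  -- Y(Z f_i) = Z(Y f_i) = Z(Y_⊥ f_i), because T(f_i) is constant; then Z = ∑ Z(f_j) X_j closes the
  -- system. Its matrix is X_j(Y_⊥ f_i) = [X_j, Y_⊥] f_i + Y_⊥(X_j f_i), both small.
  refine H.polyOrder_of_transport hF k (g := fun i => fieldDeriv Z (f i)) (r := fun _ => 0)
    (c := fun i j => fieldDeriv (X j) (fieldDeriv Yp (f i))) (fun i j => ?_) (fun i j => ?_)
    (fun i => ?_) (fun i => ?_) i
  · obtain ⟨c, hc⟩ := hF.deriv i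
    refine ((H.small_bracketDeriv (hF.const j) hc).add
      (H.small_fieldDeriv (isInvariantFun_fieldDeriv hc (hF.const j)))).congr
      (Eventually.of_forall fun x => ?_)
    rw [bracketDeriv, SmoothFun.sub_apply, sub_add_cancel]
  · obtain ⟨c, hc⟩ := hF.deriv i
    exact (H.polyFun_fieldDeriv_of_const hc).fieldDeriv (hF.const j)
  · exact polyFun_of_eventually_const (c := 0) (Eventually.of_forall fun _ => rfl) k
  · obtain ⟨c, hc⟩ := hF.deriv i
    filter_upwards [hZ.comm (f i), fieldDeriv_of_eventually_const hc Z,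
      hF.fieldDeriv_eq Z (fieldDeriv Yp (f i))] with x h1 h2 h3
    rw [← h1, fieldDeriv_add_field, map_add, SmoothFun.add_apply, h2, h3, SmoothFun.add_apply,
      add_comm, SmoothFun.sum_apply, SmoothFun.sum_apply]
    simp only [SmoothFun.mul_apply, mul_comm]

/-- A function with constant derivative along `T + Yp` has polynomially growing derivatives
along the fields commuting with `T`. -/
theorem polyFun_fieldDeriv_of_add_const (H : IsPerturbation τ T Yp)
    (hF : IsInvariantFrame T f X) {u : SmoothFun n M} {c : ℝ}
    (hu : ∀ᶠ x in cocompact M, fieldDeriv (T + Yp) u x = c) {Z : SmoothField n M}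
    (hZ : IsConstantField T Z) : PolyFun τ T (fieldDeriv Z u) := by
  intro k
  refine hF.polyOrder_fieldDeriv H.tendsto H.deriv_eq_one (fun i => ?_) hZ
  -- X_i(Y u) = 0 leaves Y(X_i u) = -[X_i, Y_⊥] u, which is expanded in the frame.
  refine H.polyOrder_of_transport hF k (g := fun i => fieldDeriv (X i) u) (r := fun _ => 0)
    (c := fun i j => - bracketDeriv (X i) Yp (f j)) (fun i j => ?_) (fun i j => ?_)
    (fun i => ?_) (fun i => ?_) i
  · obtain ⟨c, hc⟩ := hF.deriv j
    exact (H.small_bracketDeriv (hF.const i) hc).neg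
  · obtain ⟨c, hc⟩ := hF.deriv j
    refine (PolyFun.sub H.tendsto (f := 0) (polyFun_of_eventually_const (c := 0)
      (Eventually.of_forall fun _ => rfl)) (H.polyFun_bracketDeriv (hF.const i) hc)).congr
      (Eventually.of_forall fun x => ?_)
    rw [zero_sub]
  · exact polyFun_of_eventually_const (c := 0) (Eventually.of_forall fun _ => rfl) k
  · filter_upwards [fieldDeriv_add_fieldDeriv (Yp := Yp) (hF.const i) u,
      fieldDeriv_of_eventually_const hu (X i), hF.bracketDeriv_eq (X i) Yp u] with x h1 h2 h3
    rw [h1, SmoothFun.sub_apply, h2, h3, SmoothFun.add_apply, SmoothFun.sum_apply,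
      SmoothFun.sum_apply, SmoothFun.zero_apply, zero_sub, add_zero, ← Finset.sum_neg_distrib]
    simp only [SmoothFun.mul_apply, SmoothFun.neg_apply, neg_mul]

end IsPerturbation

end Perturbation

/-! ### Comparison of polynomially growing forms -/

section Forms

variable {n : ℕ} {M : Type*} [TopologicalSpace M] [ChartedSpace (Model n) M]
  [IsManifold (𝓡 n) ∞ M]

theorem SmoothForm.contMDiff_apply {r : ℕ} (η : SmoothForm n M r) (Z : Fin r → SmoothField n M) :
    ContMDiff (𝓡 n) 𝓘(ℝ, ℝ) ∞ (fun x => η.toFun x (fun i => Z i x)) := by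
  intro x₀
  let e := trivializationAt (Model n) (TangentSpace (𝓡 n) : M → Type _) x₀
  have h1 := η.smooth x₀
  have h2 (i : Fin r) : ContMDiffAt (𝓡 n) 𝓘(ℝ, Model n) ∞ (fun x => (e ⟨x, Z i x⟩).2) x₀ :=
    (Bundle.contMDiffAt_section x₀).1 (Z i).contMDiff.contMDiffAt
  have h3 : ContMDiffAt (𝓡 n) 𝓘(ℝ, Fin r → Model n) ∞ (fun x i => (e ⟨x, Z i x⟩).2) x₀ :=
    contMDiffAt_pi_space.2 h2
  let ev : (Model n [⋀^Fin r]→L[ℝ] ℝ) →L[ℝ] _ :=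
    ContinuousAlternatingMap.toContinuousMultilinearMapCLM ℝ
  have h4 := (ev.analyticAt_uncurry_of_multilinear (x := ((η.toFun x₀).compContinuousLinearMap
    (e.symmL ℝ x₀), fun i => (e ⟨x₀, Z i x₀⟩).2))).contDiffAt (n := ∞)
  have h5 := h4.contMDiffAt.comp x₀ (h1.prodMk_space h3)
  refine h5.congr_of_eventuallyEq ?_
  filter_upwards [e.open_baseSet.mem_nhds (FiberBundle.mem_baseSet_trivializationAt' x₀)] with x hx
  change _ = η.toFun x (fun i => e.symmL ℝ x (e ⟨x, Z i x⟩).2)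
  congr 1
  ext i : 1
  have := e.symmL_continuousLinearMapAt (R := ℝ) hx (Z i x)
  rw [Bundle.Trivialization.continuousLinearMapAt_apply,
    Bundle.Trivialization.coe_linearMapAt_of_mem _ hx] at this
  exact this.symm

/-- The evaluation of a smooth form on smooth vector fields. -/
def SmoothForm.eval {r : ℕ} (η : SmoothForm n M r) (Z : Fin r → SmoothField n M) :
    SmoothFun n M := ⟨_, η.contMDiff_apply Z⟩

variable [T2Space M] {κ : Type*} [Fintype κ] {τ : SmoothFun n M} {T S : SmoothField n M}
  {X : κ → SmoothField n M}

/-- An S-derivative of u is ∑ c_i X_i(u), which is again of polynomial growth for T, so the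
induction continues. -/
theorem PolyFun.transfer (hτ : Tendsto τ (cocompact M) atTop) (hX : ∀ i, IsConstantField T (X i))
    (h : ∀ Z, IsConstantField S Z → ∃ c : κ → SmoothFun n M, (∀ i, PolyFun τ T (c i)) ∧
      ∀ᶠ x in cocompact M, Z x = ∑ i, c i x • X i x) {u : SmoothFun n M} (hu : PolyFun τ T u) :
    PolyFun τ S u := by
  intro k
  induction k generalizing u with
  | zero => exact hu 0
  | succ k ih =>
    refine ⟨(hu 0).growth, fun Z hZ => ih ?_⟩
    obtain ⟨c, hc, hsum⟩ := h Z hZ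
    refine (PolyFun.sum hτ Finset.univ fun i _ => (hc i).mul hτ (hu.fieldDeriv (hX i))).congr ?_
    filter_upwards [hsum] with x hx
    rw [SmoothFun.sum_apply, fieldDeriv_apply, hx, map_sum]
    refine Finset.sum_congr rfl fun i _ => ?_
    rw [map_smul]
    rfl

/-- Multilinear expansion of η in the X_i over all maps σ : Fin r → κ. -/
theorem PolyFun.eval_transfer (hτ : Tendsto τ (cocompact M) atTop)
    (hX : ∀ i, IsConstantField T (X i))
    (h : ∀ Z, IsConstantField S Z → ∃ c : κ → SmoothFun n M, (∀ i, PolyFun τ T (c i)) ∧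
      ∀ᶠ x in cocompact M, Z x = ∑ i, c i x • X i x) {r : ℕ} {η : SmoothForm n M r}
    (hη : ∀ Z : Fin r → SmoothField n M, (∀ i, IsConstantField T (Z i)) → PolyFun τ T (η.eval Z))
    {Z : Fin r → SmoothField n M} (hZ : ∀ i, IsConstantField S (Z i)) :
    PolyFun τ S (η.eval Z) := by
  refine PolyFun.transfer hτ hX h ?_
  choose c hc hsum using fun i => h (Z i) (hZ i)
  refine (PolyFun.sum hτ Finset.univ fun (σ : Fin r → κ) _ =>
    (PolyFun.prod hτ Finset.univ fun a _ => hc a (σ a)).mul hτ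
      (hη (fun a => X (σ a)) fun a => hX _)).congr ?_
  filter_upwards [eventually_all.2 hsum] with x hx
  change η.toFun x (fun i => Z i x) = _
  simp only [hx, ContinuousAlternatingMap.map_sum, SmoothFun.sum_apply, SmoothFun.mul_apply,
    SmoothFun.prod_apply, ContinuousAlternatingMap.map_smul_univ]
  rfl

theorem mem_polynomialForms_iff {t : M → ℝ} (hτ : Tendsto τ (cocompact M) atTop)
    (ht : ∀ᶠ x in cocompact M, t x = τ x) {r : ℕ} {η : SmoothForm n M r} :
    η ∈ polynomialForms t T r ↔ ∀ Z : Fin r → SmoothField n M, (∀ i, IsConstantField T (Z i)) →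
      PolyFun τ T (η.eval Z) :=
  forall₂_congr fun Z _ => (hasPolynomialGrowth_iff hτ ht).trans
    ⟨fun ⟨_, h⟩ => h, fun h => ⟨η.contMDiff_apply Z, h⟩⟩

theorem IsPerturbation.polynomialForms_eq {t : M → ℝ} {Yp : SmoothField n M}
    (H : IsPerturbation τ T Yp) (ht : ∀ᶠ x in cocompact M, t x = τ x)
    {κ κ' : Type u} [Fintype κ] [Fintype κ'] {f : κ → SmoothFun n M} {X : κ → SmoothField n M}
    (hF : IsInvariantFrame T f X) {f' : κ' → SmoothFun n M} {X' : κ' → SmoothField n M}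
    (hF' : IsInvariantFrame (T + Yp) f' X') (r : ℕ) :
    polynomialForms t T r = polynomialForms t (T + Yp) r := by
  have h1 (Z : SmoothField n M) (hZ : IsConstantField (T + Yp) Z) : ∃ c : κ → SmoothFun n M,
      (∀ i, PolyFun τ T (c i)) ∧ ∀ᶠ x in cocompact M, Z x = ∑ i, c i x • X i x :=
    ⟨fun i => fieldDeriv Z (f i), H.polyFun_fieldDeriv_of_isConstantField_add hF hZ,
      hF.sum_eq.mono fun x hx => (hx (Z x)).symm⟩
  have h2 (Z : SmoothField n M) (hZ : IsConstantField T Z) : ∃ c : κ' → SmoothFun n M,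
      (∀ i, PolyFun τ (T + Yp) (c i)) ∧ ∀ᶠ x in cocompact M, Z x = ∑ i, c i x • X' i x := by
    refine ⟨fun i => fieldDeriv Z (f' i), fun i => ?_, hF'.sum_eq.mono fun x hx => (hx (Z x)).symm⟩
    obtain ⟨c, hc⟩ := hF'.deriv i
    -- The transport argument gives polynomial growth with respect to T; `h1` converts it to growth
    -- with respect to T + Y_⊥. Hence Y_⊥ need not be an admissible perturbation relative to T +
    -- Y_⊥.
    exact PolyFun.transfer H.tendsto hF.const h1 (H.polyFun_fieldDeriv_of_add_const hF hc hZ)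
  ext η
  rw [mem_polynomialForms_iff H.tendsto ht, mem_polynomialForms_iff H.tendsto ht]
  exact ⟨fun h Z hZ => PolyFun.eval_transfer H.tendsto hF.const h1 h hZ,
    fun h Z hZ => PolyFun.eval_transfer H.tendsto hF'.const h2 h hZ⟩

end Forms

/-! ### Smooth local flows on manifolds -/

section LocalFlow

variable {n : ℕ} {M : Type*} [TopologicalSpace M] [ChartedSpace (Model n) M]
  [IsManifold (𝓡 n) ∞ M]

theorem contDiffOn_chartField (X : SmoothField n M) (p : M) :
    ContDiffOn ℝ ∞ (chartField X p) (extChartAt (𝓡 n) p).target := by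
  intro y hy
  have h1 : ContMDiffWithinAt (𝓡 n) (𝓡 n).tangent ∞
      (fun x => (⟨x, X x⟩ : TangentBundle (𝓡 n) M)) univ ((extChartAt (𝓡 n) p).symm y) :=
    X.contMDiff _
  have h2 := h1.mpullbackWithin_vectorField_of_mem (s := range (𝓡 n)) (n := ∞)
    (contMDiffWithinAt_extChartAt_symm_range _ hy)
    (isInvertible_mfderivWithin_extChartAt_symm hy) (by simp)
    (𝓡 n).uniqueMDiffOn (by simp) univ_mem
  exact (contMDiffWithinAt_vectorSpace_iff_contDiffWithinAt.1 h2).mono (by simp)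

theorem hasMFDerivAt_extChartAt_symm_comp (X : SmoothField n M) (p : M) {c : ℝ → Model n} {s : ℝ}
    (hs : c s ∈ (extChartAt (𝓡 n) p).target) (hc : HasDerivAt c (chartField X p (c s)) s) :
    HasMFDerivAt 𝓘(ℝ, ℝ) (𝓡 n) ((extChartAt (𝓡 n) p).symm ∘ c) s
      ((1 : ℝ →L[ℝ] ℝ).smulRight (X ((extChartAt (𝓡 n) p).symm (c s)))) := by
  have h1 := (mdifferentiableWithinAt_extChartAt_symm hs).hasMFDerivWithinAt
  obtain ⟨e, he⟩ := isInvertible_mfderivWithin_extChartAt_symm (I := 𝓡 n) hs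
  have h2 : chartField X p (c s) = e.symm (X ((extChartAt (𝓡 n) p).symm (c s))) := by
    rw [chartField, VectorField.mpullbackWithin_apply, ← he, ContinuousLinearMap.inverse_equiv]
    rfl
  rw [← he, ModelWithCorners.range_eq_univ, hasMFDerivWithinAt_univ] at h1
  have h3 := h1.comp s hc.hasFDerivAt.hasMFDerivAt
  refine h3.congr_mfderiv ?_
  refine ContinuousLinearMap.ext fun (r : ℝ) => ?_
  have h4 : e (r • e.symm (X ((extChartAt (𝓡 n) p).symm (c s)))) =
      r • X ((extChartAt (𝓡 n) p).symm (c s)) := by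
    rw [map_smul, e.apply_symm_apply]
  rw [← h2] at h4
  exact h4

theorem exists_contDiff_eventuallyEq {w : Model n → Model n} {U : Set (Model n)} (hU : IsOpen U)
    (hw : ContDiffOn ℝ ∞ w U) {y : Model n} (hy : y ∈ U) :
    ∃ f : Model n → Model n, ContDiff ℝ ∞ f ∧ f =ᶠ[𝓝 y] w := by
  obtain ⟨r, hr, hrU⟩ := Metric.nhds_basis_closedBall.mem_iff.1 (hU.mem_nhds hy)
  let χ : ContDiffBump y := ⟨r / 2, r, half_pos hr, half_lt_self hr⟩
  refine ⟨fun z => χ z • w z, contDiff_iff_contDiffAt.2 fun z => ?_, ?_⟩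
  · by_cases hz : z ∈ Metric.closedBall y r
    · exact χ.contDiff.contDiffAt.smul (hw.contDiffAt (hU.mem_nhds (hrU hz)))
    · refine (contDiffAt_const (c := 0)).congr_of_eventuallyEq ?_
      filter_upwards [Metric.isClosed_closedBall.isOpen_compl.mem_nhds hz] with z' hz'
      rw [χ.zero_of_le_dist (not_le.1 fun h => hz' (Metric.mem_closedBall.2 h)).le, zero_smul]
  · filter_upwards [χ.eventuallyEq_one] with z hz
    rw [hz, Pi.one_apply, one_smul]

/-- The local flow of a smooth vector field. -/
theorem exists_smooth_local_flow (X : SmoothField n M) (p : M) :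
    ∃ (Ψ : ℝ × M → M) (ε : ℝ), 0 < ε ∧
      (∀ k : ℕ, ContMDiffAt (𝓘(ℝ, ℝ).prod (𝓡 n)) (𝓡 n) k Ψ (0, p)) ∧
      ∀ᶠ x in 𝓝 p, Ψ (0, x) = x ∧ IsMIntegralCurveOn (fun s => Ψ (s, x)) X (Ioo (-ε) ε) := by
  set e := extChartAt (𝓡 n) p with he
  have hp : e p ∈ e.target := mem_extChartAt_target p
  have hopen : IsOpen e.target := isOpen_extChartAt_target p
  obtain ⟨f, hf, hfw⟩ := exists_contDiff_eventuallyEq hopen (contDiffOn_chartField X p) hp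
  obtain ⟨Φ, ε, hε, hΦ, hflow⟩ := exists_local_flow f hf (e p)
  have h0 : Φ (0, e p) = e p := (hflow _ (Metric.mem_ball_self hε)).1
  have hev : ∀ᶠ q in 𝓝 (0, e p), Φ q ∈ e.target ∧ f (Φ q) = chartField X p (Φ q) := by
    have h1 : Tendsto Φ (𝓝 (0, e p)) (𝓝 (e p)) := by
      simpa only [h0] using! (hΦ 0).continuousAt.tendsto
    exact h1.eventually ((hopen.eventually_mem hp).and hfw)
  obtain ⟨δ, hδ, hball⟩ := Metric.eventually_nhds_iff_ball.1 hev
  refine ⟨fun q => e.symm (Φ (q.1, e q.2)), min ε δ, lt_min hε hδ, fun k => ?_, ?_⟩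
  · have h1 : ContMDiffAt (𝓘(ℝ, ℝ).prod (𝓡 n)) 𝓘(ℝ, ℝ × Model n) k
        (fun q : ℝ × M => (q.1, e q.2)) (0, p) := by
      rw [modelWithCornersSelf_prod, ← chartedSpaceSelf_prod]
      exact contMDiffAt_fst.prodMk ((contMDiffAt_extChartAt (x := p)).comp _ contMDiffAt_snd)
    have h2 : ContMDiffAt 𝓘(ℝ, Model n) (𝓡 n) k e.symm (Φ (0, e p)) := by
      rw [h0]
      exact (contMDiffOn_extChartAt_symm p).contMDiffAt (hopen.mem_nhds hp)
    exact h2.comp (0, p) ((hΦ k).contMDiffAt.comp (0, p) h1)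
  · have h1 : ∀ᶠ x in 𝓝 p, x ∈ e.source ∧ e x ∈ Metric.ball (e p) (min ε δ) :=
      ((isOpen_extChartAt_source p).eventually_mem (mem_extChartAt_source p)).and
        ((continuousAt_extChartAt p).eventually (Metric.ball_mem_nhds _ (lt_min hε hδ)))
    filter_upwards [h1] with x ⟨hx, hxb⟩
    obtain ⟨h2, h3⟩ := hflow (e x) (Metric.ball_subset_ball (min_le_left _ _) hxb)
    refine ⟨?_, fun s hs => ?_⟩
    · rw [h2, e.left_inv hx]
    · have h4 : (s, e x) ∈ Metric.ball ((0 : ℝ), e p) δ := by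
        rw [← ball_prod_same]
        refine ⟨?_, Metric.ball_subset_ball (min_le_right _ _) hxb⟩
        rw [Real.ball_eq_Ioo, zero_sub, zero_add]
        exact ⟨(neg_le_neg (min_le_right _ _)).trans_lt hs.1, hs.2.trans_le (min_le_right _ _)⟩
      obtain ⟨h5, h6⟩ := hball _ h4
      have h7 := h3 s ⟨(neg_le_neg (min_le_left _ _)).trans_lt hs.1,
        hs.2.trans_le (min_le_left _ _)⟩
      rw [h6] at h7
      exact (hasMFDerivAt_extChartAt_symm_comp X p h5 h7).hasMFDerivWithinAt

theorem SmoothField.contMDiff_one (X : SmoothField n M) :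
    ContMDiff (𝓡 n) (𝓡 n).tangent 1 (fun x => (⟨x, X x⟩ : TangentBundle (𝓡 n) M)) :=
  X.contMDiff.of_le (by simp)

end LocalFlow

/-! ### Smooth global flows of complete fields -/

section GlobalFlow

variable {n : ℕ} {M : Type*} [TopologicalSpace M] [ChartedSpace (Model n) M]
  [IsManifold (𝓡 n) ∞ M]

/-- A smooth one-parameter group of diffeomorphisms generated by a vector field. -/
structure IsFlow (X : SmoothField n M) (φ : ℝ × M → M) : Prop where
  zero (x : M) : φ (0, x) = x
  curve (x : M) : IsMIntegralCurve (fun s => φ (s, x)) X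
  smooth : ContMDiff (𝓘(ℝ, ℝ).prod (𝓡 n)) (𝓡 n) ∞ φ
  add (s r : ℝ) (x : M) : φ (s + r, x) = φ (s, φ (r, x))

variable [T2Space M]

/-- A complete vector field has a global smooth flow. -/
theorem exists_isFlow {X : SmoothField n M}
    (h : ∀ x, ∃ γ : ℝ → M, γ 0 = x ∧ IsMIntegralCurve γ X) : ∃ φ, IsFlow X φ := by
  have : IsManifold (𝓡 n) 1 M := IsManifold.of_le (n := ∞) (by simp)
  choose γ hγ0 hγ using h
  set φ : ℝ × M → M := fun q => γ q.2 q.1 with hφ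
  have hadd (s r : ℝ) (x : M) : φ (s + r, x) = φ (s, φ (r, x)) := by
    refine congrFun (isMIntegralCurve_Ioo_eq_of_contMDiff_boundaryless (t₀ := 0) (I := 𝓡 n)
      X.contMDiff_one ((hγ x).comp_add r) (hγ (γ x r)) ?_) s
    simp [hγ0]
  have hlocal (k : ℕ) (p : M) :
      ContMDiffAt (𝓘(ℝ, ℝ).prod (𝓡 n)) (𝓡 n) k φ (0, p) := by
    obtain ⟨Ψ, ε, hε, hΨ, hev⟩ := exists_smooth_local_flow X p
    refine (hΨ k).congr_of_eventuallyEq ?_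
    rw [nhds_prod_eq]
    filter_upwards [prod_mem_prod (Ioo_mem_nhds (neg_lt_zero.2 hε) hε) hev] with ⟨s, x⟩ hq
    refine isMIntegralCurveOn_Ioo_eqOn_of_contMDiff_boundaryless (I := 𝓡 n)
      (γ := fun s => φ (s, x)) (γ' := fun s => Ψ (s, x)) (t₀ := 0) ⟨neg_lt_zero.2 hε, hε⟩
      X.contMDiff_one ((hγ x).isMIntegralCurveOn _) hq.2.2 ?_ hq.1
    exact (hγ0 x).trans hq.2.1.symm
  refine ⟨φ, hγ0, hγ, contMDiff_infty.2 fun k => ?_, hadd⟩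
  have : IsManifold (𝓡 n) k M := IsManifold.of_le (n := ∞) (by exact_mod_cast le_top)
  have : IsManifold (𝓘(ℝ, ℝ).prod (𝓡 n)) k (ℝ × M) := inferInstance
  rintro ⟨s, p⟩
  -- S is open, closed and contains 0. The order k is finite because being C^k at a point spreads to
  -- a neighbourhood only for finite k.
  let S : Set ℝ := {s | ContMDiffAt (𝓘(ℝ, ℝ).prod (𝓡 n)) (𝓡 n) k φ (s, p)}
  have hk : ((k : ℕ∞) : WithTop ℕ∞) ≠ ∞ := by exact_mod_cast ENat.natCast_ne_top k
  have hS : IsOpen S := isOpen_iff_mem_nhds.2 fun s hs => by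
    have h1 := (contMDiffAt_iff_contMDiffAt_nhds hk).1 hs
    exact (Continuous.prodMk_left p).continuousAt.eventually h1
  have hS' : IsClosed S := by
    refine isClosed_of_closure_subset fun s hs => ?_
    have h1 := (contMDiffAt_iff_contMDiffAt_nhds hk).1 (hlocal k (φ (s, p)))
    have h2 : Tendsto (fun r => (s - r, φ (r, p))) (𝓝 s) (𝓝 (0, φ (s, p))) := by
      have : Continuous fun r => (s - r, φ (r, p)) :=
        (continuous_const.sub continuous_id).prodMk (hγ p).continuous
      simpa using this.tendsto s
    obtain ⟨r, hr, hrS⟩ := mem_closure_iff_frequently.1 hs |>.and_eventually (h2.eventually h1)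
      |>.exists
    -- The group law factors φ near (s, p) through the time r ∈ S and a short time, where the local
    -- flow is smooth.
    have h3 : φ = fun q => φ (q.1 - r, φ (r, q.2)) := by
      ext q
      rw [← hadd, sub_add_cancel]
    change ContMDiffAt _ _ _ _ _
    rw [h3]
    have h4 : ContMDiffAt (𝓡 n) (𝓡 n) k (fun x => φ (r, x)) p :=
      ContMDiffAt.comp p hr (contMDiffAt_const.prodMk contMDiffAt_id)
    refine ContMDiffAt.comp (s, p) (f := fun q : ℝ × M => (q.1 - r, φ (r, q.2))) hrS ?_
    exact (contMDiffAt_fst.sub contMDiffAt_const).prodMk (h4.comp (s, p) contMDiffAt_snd)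
  have hS'' : S = univ := IsClopen.eq_univ ⟨hS', hS⟩ ⟨0, hlocal k p⟩
  exact hS''.ge (mem_univ s)

end GlobalFlow

/-! ### Completeness of fields with bounded derivative of an exhaustion function -/

section Complete

variable {n : ℕ} {M : Type*} [TopologicalSpace M] [ChartedSpace (Model n) M]
  [IsManifold (𝓡 n) ∞ M]

theorem exists_uniform_time (X : SmoothField n M) {K : Set M} (hK : IsCompact K) :
    ∃ ε : ℝ, 0 < ε ∧ ∀ x ∈ K, ∃ γ : ℝ → M, γ 0 = x ∧ IsMIntegralCurveOn γ X (Ioo (-ε) ε) := by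
  refine hK.induction_on ⟨1, one_pos, fun x hx => hx.elim⟩ ?_ ?_ ?_
  · rintro s t hst ⟨ε, hε, h⟩
    exact ⟨ε, hε, fun x hx => h x (hst hx)⟩
  · rintro s t ⟨ε, hε, h⟩ ⟨ε', hε', h'⟩
    refine ⟨min ε ε', lt_min hε hε', fun x hx => ?_⟩
    rcases hx with hx | hx
    · obtain ⟨γ, h0, hγ⟩ := h x hx
      exact ⟨γ, h0, hγ.mono (Ioo_subset_Ioo (neg_le_neg (min_le_left _ _)) (min_le_left _ _))⟩
    · obtain ⟨γ, h0, hγ⟩ := h' x hx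
      exact ⟨γ, h0, hγ.mono (Ioo_subset_Ioo (neg_le_neg (min_le_right _ _)) (min_le_right _ _))⟩
  · intro p _
    obtain ⟨Ψ, ε, hε, -, hev⟩ := exists_smooth_local_flow X p
    exact ⟨_, mem_nhdsWithin_of_mem_nhds hev, ε, hε, fun x hx => ⟨_, hx.1, hx.2⟩⟩

omit [IsManifold (𝓡 n) ∞ M] in
theorem isCompact_preimage_Iic {τ : SmoothFun n M} (hτ : Tendsto τ (cocompact M) atTop) (b : ℝ) :
    IsCompact (τ ⁻¹' Iic b) := by
  obtain ⟨K, hK, hP⟩ := eventually_cocompact_iff.1 (hτ.eventually_gt_atTop b)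
  refine hK.of_isClosed_subset (isClosed_Iic.preimage τ.contMDiff.continuous) fun x hx => ?_
  by_contra hxK
  exact absurd hx (not_le.2 (hP x hxK))

variable [T2Space M]

theorem complete_of_eq_zero_off_compact {X : SmoothField n M} {K : Set M} (hK : IsCompact K)
    (hX : ∀ x ∉ K, X x = 0) (x : M) : ∃ γ : ℝ → M, γ 0 = x ∧ IsMIntegralCurve γ X := by
  have : IsManifold (𝓡 n) 1 M := IsManifold.of_le (n := ∞) (by simp)
  obtain ⟨ε, hε, h⟩ := exists_uniform_time X hK
  refine exists_isMIntegralCurve_of_isMIntegralCurveOn X.contMDiff_one hε (fun x => ?_) x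
  by_cases hx : x ∈ K
  · exact h x hx
  · exact ⟨fun _ => x, rfl, (isMIntegralCurve_const (hX x hx)).isMIntegralCurveOn _⟩

/-- A smooth cutoff function of `τ`, equal to one below level `R` and to zero above `R + 1`. -/
def levelCutoff (τ : SmoothFun n M) (R : ℝ) : SmoothFun n M :=
  ⟨fun x => Real.smoothTransition (R + 1 - τ x),
    Real.smoothTransition.contDiff.contMDiff.comp (contMDiff_const.sub τ.contMDiff)⟩

theorem complete_of_bounded_fieldDeriv {τ : SmoothFun n M} (hτ : Tendsto τ (cocompact M) atTop)
    {T : SmoothField n M} {C : ℝ} (hC : ∀ x, |fieldDeriv T τ x| ≤ C) (x : M) :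
    ∃ γ : ℝ → M, γ 0 = x ∧ IsMIntegralCurve γ T := by
  have : IsManifold (𝓡 n) 1 M := IsManifold.of_le (n := ∞) (by simp)
  refine (exists_isMIntegralCurve_iff_exists_isMIntegralCurveOn_Ioo T.contMDiff_one x).2
    fun a => ?_
  -- The cut-off field has compact support and so is complete. Along its curves τ changes at speed
  -- at most C, so for |s| < a the curve from x stays where χ = 1 and is an integral curve of T.
  set χ := levelCutoff τ (τ x + C * a)
  obtain ⟨γ, h0, hγ⟩ := complete_of_eq_zero_off_compact (X := smulField χ T)
    (isCompact_preimage_Iic hτ (τ x + C * a + 1)) (fun y hy => by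
      have h1 : χ y = 0 := Real.smoothTransition.zero_of_nonpos
        (sub_nonpos.2 (not_le.1 hy).le)
      change χ y • T y = 0
      rw [h1, zero_smul]) x
  have hC0 : 0 ≤ C := (abs_nonneg _).trans (hC x)
  have hd (s : ℝ) : HasDerivAt (τ ∘ γ) (fieldDeriv (smulField χ T) τ (γ s)) s :=
    hasDerivAt_comp_integralCurve (hγ.isMIntegralCurveAt s) (τ.mdifferentiableAt _)
  have hbound (s : ℝ) : ‖fieldDeriv (smulField χ T) τ (γ s)‖ ≤ C := by
    rw [fieldDeriv_smulField, SmoothFun.mul_apply, Real.norm_eq_abs, abs_mul]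
    have h1 : |χ (γ s)| ≤ 1 := abs_le.2
      ⟨(by norm_num : (-1 : ℝ) ≤ 0).trans (Real.smoothTransition.nonneg _),
        Real.smoothTransition.le_one _⟩
    exact (mul_le_mul h1 (hC _) (abs_nonneg _) zero_le_one).trans_eq (one_mul C)
  refine ⟨γ, h0, fun s hs => ?_⟩
  have h1 := convex_univ.norm_image_sub_le_of_norm_hasDerivWithin_le
    (fun s _ => (hd s).hasDerivWithinAt) (fun s _ => hbound s) (mem_univ 0) (mem_univ s)
  have h2 : τ (γ s) ≤ τ x + C * a := by
    have h3 : |s| ≤ a := abs_le.2 ⟨hs.1.le, hs.2.le⟩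
    have h4 := (le_abs_self _).trans h1
    rw [Function.comp_apply, Function.comp_apply, h0, sub_zero, Real.norm_eq_abs] at h4
    linarith [mul_le_mul_of_nonneg_left h3 hC0]
  have h3 : χ (γ s) = 1 := Real.smoothTransition.one_of_one_le (by linarith)
  have h4 : smulField χ T (γ s) = T (γ s) := by
    change χ (γ s) • T (γ s) = T (γ s)
    rw [h3, one_smul]
  rw [← h4]
  exact (hγ s).hasMFDerivWithinAt

/-- A vector field `T` with `T(τ) = 1` at infinity has a global flow. -/
theorem exists_isFlow_of_deriv_eq_one {τ : SmoothFun n M} (hτ : Tendsto τ (cocompact M) atTop)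
    {T : SmoothField n M} (hT : ∀ᶠ x in cocompact M, fieldDeriv T τ x = 1) :
    ∃ φ, IsFlow T φ := by
  obtain ⟨K, hK, h1⟩ := eventually_cocompact_iff.1 hT
  obtain ⟨C, hC⟩ := hK.exists_bound_of_continuousOn
    (fieldDeriv T τ).contMDiff.continuous.continuousOn
  refine exists_isFlow fun x => complete_of_bounded_fieldDeriv hτ (C := max C 1) (fun y => ?_) x
  by_cases hy : y ∈ K
  · exact (hC y hy).trans (le_max_left _ _)
  · rw [h1 y hy, abs_one]
    exact le_max_right _ _

end Complete

/-! ### Smoothing the function of a cylindrical structure -/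

section Proper

variable {n : ℕ} {M : Type*} [TopologicalSpace M] [ChartedSpace (Model n) M]
  [IsManifold (𝓡 n) ∞ M] [T2Space M]

omit [T2Space M] in
theorem sigmaCompactSpace_of_isProperMap {t : M → ℝ} (ht : IsProperMap t) :
    SigmaCompactSpace M := by
  refine ⟨⟨fun k : ℕ => t ⁻¹' Icc (-k) k, fun k => ht.isCompact_preimage isCompact_Icc, ?_⟩⟩
  refine eq_univ_of_forall fun x => mem_iUnion.2 ?_
  obtain ⟨k, hk⟩ := exists_nat_ge |t x|
  exact ⟨k, abs_le.1 hk⟩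

/-- The function of a cylindrical structure can be made smooth without changing it at infinity. -/
theorem IsCylindricalStructure.exists_smooth {t : M → ℝ} {T : SmoothField n M}
    (h : IsCylindricalStructure t T) : ∃ τ : SmoothFun n M, Tendsto τ (cocompact M) atTop ∧
      (∀ᶠ x in cocompact M, t x = τ x) ∧ ∀ᶠ x in cocompact M, fieldDeriv T τ x = 1 := by
  have := sigmaCompactSpace_of_isProperMap h.proper
  have := Manifold.locallyCompact_of_finiteDimensional (M := M) (𝓡 n)
  obtain ⟨K, hK, hsm⟩ := h.smooth_near_infinity
  obtain ⟨a, ha⟩ := h.bounded_below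
  obtain ⟨L, hL, hKL⟩ := exists_compact_superset hK
  obtain ⟨χ, hχ0, hχ1, -⟩ := exists_contMDiffMap_zero_one_nhds_of_isClosed (𝓡 n) (n := ⊤)
    hK.isClosed isOpen_interior.isClosed_compl (disjoint_compl_right_iff_subset.2 hKL)
  have hτ : ContMDiff (𝓡 n) 𝓘(ℝ, ℝ) ∞ (fun x => χ x * t x) := by
    intro x
    by_cases hx : x ∈ K
    · refine (contMDiffAt_const (c := (0 : ℝ))).congr_of_eventuallyEq ?_
      filter_upwards [eventually_nhdsSet_iff_forall.1 hχ0 x hx] with y hy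
      rw [hy, zero_mul]
    · exact χ.contMDiff.contMDiffAt.mul (hsm.contMDiffAt (hK.isClosed.isOpen_compl.mem_nhds hx))
  have heq : ∀ᶠ x in cocompact M, t x = χ x * t x := by
    refine eventually_cocompact_iff.2 ⟨L, hL, fun x hx => ?_⟩
    rw [hχ1.self_of_nhdsSet x fun hx' => hx (interior_subset hx'), one_mul]
  refine ⟨⟨_, hτ⟩, ?_, heq, ?_⟩
  · refine Tendsto.congr' heq (tendsto_atTop.2 fun b => ?_)
    refine eventually_cocompact_iff.2 ⟨_, h.proper.isCompact_preimage (isCompact_Icc (a := a)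
      (b := b)), fun x hx => ?_⟩
    by_contra hb
    exact hx ⟨ha x, (not_le.1 hb).le⟩
  · filter_upwards [eventually_eventually_nhds_cocompact heq,
      eventually_cocompact_iff.2 h.deriv_eq_one] with x h1 h2
    have h3 : t =ᶠ[𝓝 x] fun x => χ x * t x := h1
    have h4 : mvfderiv (𝓡 n) t x = mvfderiv (𝓡 n) (fun x => χ x * t x) x := h3.mfderiv_eq
    rw [h4] at h2
    exact h2

end Proper

/-! ### Transport along the flow from a level of τ -/

section LevelProjection

variable {n : ℕ} {M : Type*} [TopologicalSpace M] [ChartedSpace (Model n) M]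
  [IsManifold (𝓡 n) ∞ M] {T : SmoothField n M} {φ : ℝ × M → M} {τ : SmoothFun n M} {a₀ a : ℝ}

theorem IsFlow.neg_add_cancel (h : IsFlow T φ) (s : ℝ) (x : M) : φ (s, φ (-s, x)) = x := by
  rw [← h.add, add_neg_cancel, h.zero]

theorem IsFlow.hasDerivAt (h : IsFlow T φ) (g : SmoothFun n M) (x : M) (s : ℝ) :
    HasDerivAt (fun s => g (φ (s, x))) (fieldDeriv T g (φ (s, x))) s :=
  hasDerivAt_comp_integralCurve ((h.curve x).isMIntegralCurveAt s) (g.mdifferentiableAt _)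

/-- Above the level `a₀`, the flow of `T` is a translation in the direction of `τ`. -/
theorem IsFlow.apply_eq_add (h : IsFlow T φ) (hT : ∀ x, a₀ < τ x → fieldDeriv T τ x = 1) {x : M}
    {s : ℝ} (hx : a₀ < τ x) (hs : a₀ < τ x + s) : τ (φ (s, x)) = τ x + s := by
  -- A continuity argument on the ray s > a₀ - τ x: at a time in A the curve is above level a₀,
  -- where τ has unit speed, so nearby times are in A as well.
  set A : Set ℝ := {s | τ (φ (s, x)) = τ x + s} with hA
  have hcont : Continuous fun s => τ (φ (s, x)) :=
    τ.contMDiff.continuous.comp (h.curve x).continuous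
  have hclosed : IsClosed A := isClosed_eq hcont (by fun_prop)
  have hopen : ∀ s ∈ Ioi (a₀ - τ x), s ∈ A → s ∈ interior A := by
    intro s hs hsA
    have h1 : a₀ < τ (φ (s, x)) := by
      rw [show τ (φ (s, x)) = τ x + s from hsA]
      linarith [mem_Ioi.1 hs]
    obtain ⟨δ, hδ, hball⟩ := Metric.eventually_nhds_iff_ball.1
      (hcont.continuousAt.eventually (lt_mem_nhds h1))
    refine mem_interior_iff_mem_nhds.2 (mem_of_superset (Metric.ball_mem_nhds s hδ) fun r hr => ?_)
    have h2 : ∀ r ∈ Metric.ball s δ, HasDerivWithinAt (fun s => τ (φ (s, x)) - s) 0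
        (Metric.ball s δ) r := fun r hr => by
      have h3 := (h.hasDerivAt τ x r).sub (hasDerivAt_id r)
      rw [hT _ (hball r hr), sub_self] at h3
      exact h3.hasDerivWithinAt
    have h4 := (convex_ball s δ).norm_image_sub_le_of_norm_hasDerivWithin_le (C := 0) h2
      (fun _ _ => norm_zero.le) (Metric.mem_ball_self hδ) hr
    rw [zero_mul, norm_le_zero_iff] at h4
    have h5 : τ (φ (s, x)) = τ x + s := hsA
    change τ (φ (r, x)) = τ x + r
    linarith
  have h0 : (0 : ℝ) ∈ Ioi (a₀ - τ x) := by
    rw [mem_Ioi]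
    linarith
  have h0A : (0 : ℝ) ∈ A := by
    change τ (φ (0, x)) = τ x + 0
    rw [h.zero, add_zero]
  have hsub := isPreconnected_Ioi.subset_of_closure_inter_subset isOpen_interior
    ⟨0, h0, hopen 0 h0 h0A⟩ (fun r hr => hopen r hr.2
    (hclosed.closure_subset (closure_mono interior_subset hr.1)))
  have hsA : s ∈ A := interior_subset (hsub (mem_Ioi.2 (by linarith)))
  exact hsA

/-- The projection to the level `a` of `τ` along the flow. -/
def levelProj (φ : ℝ × M → M) (τ : SmoothFun n M) (a : ℝ) (x : M) : M := φ (a - τ x, x)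

theorem IsFlow.contMDiff_levelProj (h : IsFlow T φ) (τ : SmoothFun n M) (a : ℝ) :
    ContMDiff (𝓡 n) (𝓡 n) ∞ (levelProj φ τ a) :=
  h.smooth.comp ((contMDiff_const.sub τ.contMDiff).prodMk contMDiff_id)

theorem IsFlow.apply_levelProj (h : IsFlow T φ) (τ : SmoothFun n M) (a : ℝ) (x : M) :
    φ (τ x - a, levelProj φ τ a x) = x := by
  have h1 := h.neg_add_cancel (τ x - a) x
  rwa [neg_sub] at h1

theorem IsFlow.levelProj_apply (h : IsFlow T φ) (hT : ∀ x, a₀ < τ x → fieldDeriv T τ x = 1) {x : M}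
    {s : ℝ} (hx : a₀ < τ x) (hs : a₀ < τ x + s) :
    levelProj φ τ a (φ (s, x)) = levelProj φ τ a x := by
  rw [levelProj, h.apply_eq_add hT hx hs, ← h.add, levelProj]
  congr 2
  ring

theorem IsFlow.apply_levelProj_eq (h : IsFlow T φ) (hT : ∀ x, a₀ < τ x → fieldDeriv T τ x = 1)
    (ha : a₀ < a) {x : M} (hx : a₀ < τ x) : τ (levelProj φ τ a x) = a := by
  rw [levelProj, h.apply_eq_add hT hx (by linarith)]
  ring

/-- The pullback of a function under the projection to a level of `τ`. -/
def IsFlow.pull (h : IsFlow T φ) (τ : SmoothFun n M) (a : ℝ) (g : SmoothFun n M) : SmoothFun n M :=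
  ⟨fun x => g (levelProj φ τ a x), g.contMDiff.comp (h.contMDiff_levelProj τ a)⟩

theorem IsFlow.fieldDeriv_pull (h : IsFlow T φ) (hT : ∀ x, a₀ < τ x → fieldDeriv T τ x = 1)
    (g : SmoothFun n M) {x : M} (hx : a₀ < τ x) : fieldDeriv T (h.pull τ a g) x = 0 := by
  have h1 := h.hasDerivAt (h.pull τ a g) x 0
  rw [h.zero] at h1
  refine h1.unique ((hasDerivAt_const (0 : ℝ) (g (levelProj φ τ a x))).congr_of_eventuallyEq ?_)
  have h2 : ∀ᶠ s : ℝ in 𝓝 0, a₀ < τ x + s := by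
    have : Tendsto (fun s => τ x + s) (𝓝 0) (𝓝 (τ x + 0)) := tendsto_const_nhds.add tendsto_id
    rw [add_zero] at this
    exact this.eventually (lt_mem_nhds hx)
  filter_upwards [h2] with s hs
  exact congrArg g (h.levelProj_apply hT hx hs)

/-- The field obtained by transporting `X` along the flow from a level of `τ`. -/
def IsFlow.spread (h : IsFlow T φ) (τ : SmoothFun n M) (a : ℝ) (X : SmoothField n M) :
    SmoothField n M where
  toFun x := mfderiv (𝓘(ℝ, ℝ).prod (𝓡 n)) (𝓡 n) φ (τ x - a, levelProj φ τ a x)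
    ((0 : ℝ), (X (levelProj φ τ a x) : Model n))
  contMDiff_toFun := by
    have h1 : ContMDiff (𝓡 n) 𝓘(ℝ, ℝ).tangent ∞
        (fun x : M => (⟨τ x - a, (0 : ℝ)⟩ : TangentBundle 𝓘(ℝ, ℝ) ℝ)) :=
      (Bundle.contMDiff_zeroSection ℝ (TangentSpace 𝓘(ℝ, ℝ) : ℝ → Type _)).comp
        (τ.contMDiff.sub contMDiff_const)
    have h2 : ContMDiff (𝓡 n) (𝓡 n).tangent ∞
        (fun x : M => (⟨levelProj φ τ a x, X (levelProj φ τ a x)⟩ : TangentBundle (𝓡 n) M)) :=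
      X.contMDiff.comp (h.contMDiff_levelProj τ a)
    have h3 := (h.smooth.contMDiff_tangentMap (m := ∞) (by simp)).comp
      (contMDiff_equivTangentBundleProd_symm.comp (h1.prodMk h2))
    refine h3.congr fun x => ?_
    have h4 (y : M) (hy : y = x) (v : Model n) :
        (⟨x, v⟩ : TangentBundle (𝓡 n) M) = ⟨y, v⟩ := by rw [hy]
    exact h4 _ (h.apply_levelProj τ a x) _

/-- Chain rule for g ∘ φ_s with s frozen at τ x - a. The constant c is 0 for pulled-back functions
and τ x - a for τ itself. -/
theorem IsFlow.fieldDeriv_spread (h : IsFlow T φ) (X : SmoothField n M) {g : SmoothFun n M}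
    {c : ℝ} {x : M}
    (hg : ∀ᶠ y in 𝓝 (levelProj φ τ a x), g (φ (τ x - a, y)) = g y + c) :
    fieldDeriv (h.spread τ a X) g x = h.pull τ a (fieldDeriv X g) x := by
  set p := levelProj φ τ a x with hp
  set s := τ x - a with hs
  have hx : φ (s, p) = x := h.apply_levelProj τ a x
  have hφ : HasMFDerivAt (𝓘(ℝ, ℝ).prod (𝓡 n)) (𝓡 n) φ (s, p)
      (mfderiv (𝓘(ℝ, ℝ).prod (𝓡 n)) (𝓡 n) φ (s, p)) :=
    ((h.smooth (s, p)).mdifferentiableAt (by simp)).hasMFDerivAt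
  have h1 := hφ.comp p ((hasMFDerivAt_const (I := 𝓡 n) (I' := 𝓘(ℝ, ℝ)) s p).prodMk
    (hasMFDerivAt_id p))
  have h2 := (g.mdifferentiableAt (φ (s, p))).hasMFDerivAt.comp p h1
  have h3 := (g.mdifferentiableAt p).hasMFDerivAt.add
    (hasMFDerivAt_const (I := 𝓡 n) (I' := 𝓘(ℝ, ℝ)) c p)
  have h4 := hasMFDerivAt_unique h2 (h3.congr_of_eventuallyEq hg)
  have h5 := congrArg (fun L : Model n →L[ℝ] ℝ => L (X p)) h4
  have h6 (y : M) (hy : y = x) (v : Model n) : mvfderiv (𝓡 n) g y v = mvfderiv (𝓡 n) g x v := by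
    rw [hy]
  change mvfderiv (𝓡 n) g x (mfderiv (𝓘(ℝ, ℝ).prod (𝓡 n)) (𝓡 n) φ (s, p)
    ((0 : ℝ), (X p : Model n))) = mvfderiv (𝓡 n) g p (X p)
  exact (h6 _ hx _).symm.trans (h5.trans (add_zero (mvfderiv (𝓡 n) g p (X p))))

theorem apply_prodMk_sum {E F : Type*} [NormedAddCommGroup E] [NormedSpace ℝ E]
    [NormedAddCommGroup F] [NormedSpace ℝ F] (D : ℝ × E →L[ℝ] F) (r : ℝ) {ι : Type*} [Fintype ι]
    (c : ι → ℝ) (w : ι → E) : D (r, ∑ i, c i • w i) = D (r, 0) + ∑ i, c i • D (0, w i) := by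
  have h : (r, ∑ i, c i • w i) = (r, (0 : E)) + ∑ i, c i • ((0 : ℝ), w i) := by
    refine Prod.ext ?_ ?_
    · simp [Prod.fst_sum]
    · simp [Prod.snd_sum]
  rw [h, map_add, map_sum]
  simp only [map_smul]

/-- With ψ the projection to the level, differentiate x = φ(τ x - a, ψ x): the time derivative
contributes dτ(v) T, and dψ(v) is expanded by the dual frame at ψ x. The X_i need not be tangent to
the level. -/
theorem IsFlow.smul_add_spread (h : IsFlow T φ) {ι : Type*} [Fintype ι] {f : ι → SmoothFun n M}
    {X : ι → SmoothField n M} {x : M}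
    (hf : ∀ v, ∑ i, mvfderiv (𝓡 n) (f i) (levelProj φ τ a x) v • X i (levelProj φ τ a x) = v)
    (v : TangentSpace (𝓡 n) x) :
    mvfderiv (𝓡 n) τ x v • T x +
      ∑ i, mvfderiv (𝓡 n) (h.pull τ a (f i)) x v • h.spread τ a (X i) x = v := by
  set p := levelProj φ τ a x with hp
  set s := τ x - a with hs
  have hx : φ (s, p) = x := h.apply_levelProj τ a x
  have hφ : HasMFDerivAt (𝓘(ℝ, ℝ).prod (𝓡 n)) (𝓡 n) φ (s, p)
      (mfderiv (𝓘(ℝ, ℝ).prod (𝓡 n)) (𝓡 n) φ (s, p)) :=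
    ((h.smooth (s, p)).mdifferentiableAt (by simp)).hasMFDerivAt
  have hψ : HasMFDerivAt (𝓡 n) (𝓡 n) (levelProj φ τ a) x
      (mfderiv (𝓡 n) (𝓡 n) (levelProj φ τ a) x) :=
    ((h.contMDiff_levelProj τ a x).mdifferentiableAt (by simp)).hasMFDerivAt
  have hτ := ((τ.mdifferentiableAt x).hasMFDerivAt.sub
    (hasMFDerivAt_const (I := 𝓡 n) (I' := 𝓘(ℝ, ℝ)) a x))
  let D : ℝ × Model n →L[ℝ] Model n := mfderiv (𝓘(ℝ, ℝ).prod (𝓡 n)) (𝓡 n) φ (s, p)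
  let L : Model n →L[ℝ] Model n := mfderiv (𝓡 n) (𝓡 n) (levelProj φ τ a) x
  have h1 : D (mvfderiv (𝓡 n) τ x v, L v) = v := by
    have h2 := (hφ.comp x (hτ.prodMk hψ)).congr_of_eventuallyEq (f₁ := id)
      (Eventually.of_forall fun y => (h.apply_levelProj τ a y).symm)
    have h3 := congrArg (fun A : Model n →L[ℝ] Model n => A v)
      (hasMFDerivAt_unique h2 (hasMFDerivAt_id x))
    have h4 : D (mvfderiv (𝓡 n) τ x v - 0, L v) = v := h3
    rwa [sub_zero] at h4
  have h2 (r : ℝ) : D (r, 0) = r • (T x : Model n) := by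
    have h3 := hφ.comp s ((hasMFDerivAt_id (I := 𝓘(ℝ, ℝ)) s).prodMk
      (hasMFDerivAt_const (I := 𝓘(ℝ, ℝ)) (I' := 𝓡 n) p s))
    have h4 := congrArg (fun A : ℝ →L[ℝ] Model n => A r) (hasMFDerivAt_unique h3 (h.curve p s))
    have h5 : D (r, 0) = r • (T (φ (s, p)) : Model n) := h4
    have h6 (y : M) (hy : y = x) : (T y : Model n) = (T x : Model n) := by rw [hy]
    exact h5.trans (congrArg (fun z : Model n => r • z) (h6 _ hx))
  have h3 (i : ι) : mvfderiv (𝓡 n) (h.pull τ a (f i)) x v = mvfderiv (𝓡 n) (f i) p (L v) := by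
    have h4 := ((f i).mdifferentiableAt p).hasMFDerivAt.comp x hψ
    exact congrArg (fun A : Model n →L[ℝ] ℝ => A v)
      (hasMFDerivAt_unique ((h.pull τ a (f i)).mdifferentiableAt x).hasMFDerivAt h4)
  have h4 : L v = ∑ i, mvfderiv (𝓡 n) (h.pull τ a (f i)) x v • (X i p : Model n) := by
    simp only [h3]
    exact (hf (L v)).symm
  exact (h2 (mvfderiv (𝓡 n) τ x v) ▸ apply_prodMk_sum D _ _ fun i => (X i p : Model n)).symm.trans
    (h4 ▸ h1)

theorem IsFlow.fieldDeriv_spread_pull (h : IsFlow T φ)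
    (hT : ∀ x, a₀ < τ x → fieldDeriv T τ x = 1) (ha : a₀ < a) (X : SmoothField n M)
    (g : SmoothFun n M) {x : M} (hx : a₀ < τ x) :
    fieldDeriv (h.spread τ a X) (h.pull τ a g) x =
      h.pull τ a (fieldDeriv X (h.pull τ a g)) x := by
  refine h.fieldDeriv_spread X (c := 0) ?_
  have h1 := h.apply_levelProj_eq hT ha hx
  have h2 : Tendsto τ (𝓝 (levelProj φ τ a x)) (𝓝 a) := by
    simpa only [h1] using τ.contMDiff.continuous.tendsto (levelProj φ τ a x)
  filter_upwards [h2.eventually (lt_mem_nhds ha),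
    h2.eventually (lt_mem_nhds (show a - (τ x - a₀) < a by linarith))] with y hy hy'
  rw [add_zero]
  exact congrArg g (h.levelProj_apply hT hy (by linarith))

theorem IsFlow.fieldDeriv_spread_self (h : IsFlow T φ)
    (hT : ∀ x, a₀ < τ x → fieldDeriv T τ x = 1) (ha : a₀ < a) (X : SmoothField n M)
    {x : M} (hx : a₀ < τ x) :
    fieldDeriv (h.spread τ a X) τ x = h.pull τ a (fieldDeriv X τ) x := by
  refine h.fieldDeriv_spread X (c := τ x - a) ?_
  have h1 := h.apply_levelProj_eq hT ha hx
  have h2 : Tendsto τ (𝓝 (levelProj φ τ a x)) (𝓝 a) := by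
    simpa only [h1] using τ.contMDiff.continuous.tendsto (levelProj φ τ a x)
  filter_upwards [h2.eventually (lt_mem_nhds ha),
    h2.eventually (lt_mem_nhds (show a - (τ x - a₀) < a by linarith))] with y hy hy'
  exact h.apply_eq_add hT hy (by linarith)

/-- The fields spread along the flow commute with `T` at infinity. -/
theorem IsFlow.isInvariantFrame [T2Space M] (h : IsFlow T φ) (hτ : Tendsto τ (cocompact M) atTop)
    (hT : ∀ x, a₀ < τ x → fieldDeriv T τ x = 1) (ha : a₀ < a) {ι : Type*} [Fintype ι]
    {f : ι → SmoothFun n M} {X : ι → SmoothField n M}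
    (hf : ∀ y, τ y = a → ∀ v, ∑ i, mvfderiv (𝓡 n) (f i) y v • X i y = v) :
    IsInvariantFrame T (fun o : Option ι => o.elim τ fun i => h.pull τ a (f i))
      (fun o => o.elim T fun i => h.spread τ a (X i)) := by
  have hlarge : ∀ᶠ x in cocompact M, a₀ < τ x := hτ.eventually_gt_atTop a₀
  have hTτ : ∀ᶠ x in cocompact M, fieldDeriv T τ x = 1 := hlarge.mono hT
  have hpull (g : SmoothFun n M) : EqInf (fieldDeriv T (h.pull τ a g)) 0 :=
    hlarge.mono fun x hx => h.fieldDeriv_pull hT g hx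
  have hsum : ∀ᶠ x in cocompact M, ∀ v : TangentSpace (𝓡 n) x, mvfderiv (𝓡 n) τ x v • T x +
      ∑ i, mvfderiv (𝓡 n) (h.pull τ a (f i)) x v • h.spread τ a (X i) x = v :=
    hlarge.mono fun x hx => h.smul_add_spread (hf _ (h.apply_levelProj_eq hT ha hx))
  refine ⟨?_, ?_, ?_⟩
  · rintro (_ | i)
    · refine eventually_cocompact_iff.1 (Eventually.of_forall fun x => ?_)
      exact congrFun (VectorField.mlieBracket_self (V := fun x => T x)) x
    · refine eventually_cocompact_iff.1 ?_
      -- By `hsum` the bracket vanishes once it annihilates τ and the pulled-back f_j. On each of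
      -- them T gives a constant and the spread field gives a T-invariant function, so both terms of
      -- the commutator vanish.
      have h1 (g : SmoothFun n M) {c : ℝ} (hg : ∀ᶠ x in cocompact M, fieldDeriv T g x = c)
          {g' : SmoothFun n M} (hg' : EqInf (fieldDeriv (h.spread τ a (X i)) g) (h.pull τ a g')) :
          EqInf (bracketDeriv (h.spread τ a (X i)) T g) 0 := by
        filter_upwards [fieldDeriv_of_eventually_const hg (h.spread τ a (X i)), hg'.fieldDeriv T,
          hpull g'] with x h2 h3 h4
        rw [bracketDeriv, SmoothFun.sub_apply, h2, h3, h4, sub_self]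
        rfl
      have h2 := h1 τ hTτ (hlarge.mono fun x hx => h.fieldDeriv_spread_self hT ha (X i) hx)
      have h3 (j : ι) := h1 (h.pull τ a (f j)) (hpull (f j))
        (hlarge.mono fun x hx => h.fieldDeriv_spread_pull hT ha (X i) (f j) hx)
      filter_upwards [hsum, h2, eventually_all.2 h3] with x h4 h5 h6
      change VectorField.mlieBracket (𝓡 n) (h.spread τ a (X i)) T x = 0
      rw [bracketDeriv_apply] at h5
      simp only [bracketDeriv_apply] at h6
      rw [← h4 (VectorField.mlieBracket (𝓡 n) (h.spread τ a (X i)) T x), h5]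
      simp only [h6, SmoothFun.zero_apply, zero_smul, Finset.sum_const_zero, add_zero]
  · rintro (_ | i)
    · exact ⟨1, hTτ⟩
    · exact ⟨0, hpull (f i)⟩
  · filter_upwards [hsum] with x hx v
    rw [Fintype.sum_option]
    exact hx v

end LevelProjection

/-! ### Existence of finite invariant frames -/

section ExistsFrame

variable {n : ℕ} {M : Type u} [TopologicalSpace M] [ChartedSpace (Model n) M]
  [IsManifold (𝓡 n) ∞ M] [T2Space M] [SigmaCompactSpace M]

/-- Local dual frames are glued by a partition of unity on the fields only; the functions are
already global, and no linear independence is required. -/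
theorem exists_finite_frame {K : Set M} (hK : IsCompact K) :
    ∃ (ι : Type u) (_ : Fintype ι) (f : ι → SmoothFun n M) (X : ι → SmoothField n M),
      ∀ y ∈ K, ∀ v, ∑ i, mvfderiv (𝓡 n) (f i) y v • X i y = v := by
  choose f X hfX using fun p : M => exists_dual_frame_nhds (n := n) p
  choose U hU hUo hpU using fun p => eventually_nhds_iff.1 (hfX p)
  obtain ⟨t, ht⟩ := hK.elim_finite_subcover U hUo fun p _ => mem_iUnion.2 ⟨p, hpU p⟩
  obtain ⟨ρ, hρ⟩ := SmoothPartitionOfUnity.exists_isSubordinate (𝓡 n) hK.isClosed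
    (fun p : t => U p) (fun p => hUo p) fun y hy => by
      obtain ⟨p, hp, hy⟩ := mem_iUnion₂.1 (ht hy)
      exact mem_iUnion.2 ⟨⟨p, hp⟩, hy⟩
  refine ⟨t × Fin n, inferInstance, fun q => f q.1 q.2, fun q => smulField (ρ q.1) (X q.1 q.2),
    fun y hy v => ?_⟩
  rw [Fintype.sum_prod_type]
  have h1 (p : t) : ∑ j, mvfderiv (𝓡 n) (f p j) y v • (smulField (ρ p) (X p j)) y = ρ p y • v := by
    by_cases hp : y ∈ U p
    · conv_rhs => rw [← hU p y hp v]
      rw [Finset.smul_sum]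
      exact Finset.sum_congr rfl fun j _ =>
        smul_comm (mvfderiv (𝓡 n) (f p j) y v) (ρ p y) (X p j y)
    · have h2 : ρ p y = 0 := by
        by_contra h2
        exact hp (hρ p (subset_tsupport _ h2))
      rw [h2, zero_smul]
      refine Finset.sum_eq_zero fun j _ => ?_
      change _ • (ρ p y • X p j y) = 0
      rw [h2, zero_smul, smul_zero]
  simp only [h1]
  rw [← Finset.sum_smul, ← finsum_eq_sum_of_fintype, ρ.sum_eq_one hy, one_smul]

/-- A field `T` with `T(τ) = 1` at infinity admits a finite invariant frame. -/
theorem exists_isInvariantFrame {τ : SmoothFun n M} (hτ : Tendsto τ (cocompact M) atTop)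
    {T : SmoothField n M} (hT : ∀ᶠ x in cocompact M, fieldDeriv T τ x = 1) :
    ∃ (ι : Type u) (_ : Fintype ι) (f : ι → SmoothFun n M) (X : ι → SmoothField n M),
      IsInvariantFrame T f X := by
  obtain ⟨φ, hφ⟩ := exists_isFlow_of_deriv_eq_one hτ hT
  obtain ⟨a₀, -, ha₀⟩ := exists_forall_le_of_eventually (τ := τ) hT 0
  -- The level lies strictly above a₀, so T(τ) = 1 holds on a neighbourhood of it.
  obtain ⟨ι, _, f, X, hf⟩ := exists_finite_frame (n := n)
    (isCompact_preimage_Icc hτ (a₀ + 1) (a₀ + 1))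
  exact ⟨Option ι, inferInstance, _, _, hφ.isInvariantFrame (a := a₀ + 1) hτ
    (fun x hx => ha₀ x hx.le) (lt_add_one a₀) fun y hy => hf y ⟨hy.ge, hy.le⟩⟩

end ExistsFrame

/-! ### Reduction of the theorem to smooth data at infinity -/

section Main

variable {n : ℕ} {M : Type*} [TopologicalSpace M] [ChartedSpace (Model n) M]
  [IsManifold (𝓡 n) ∞ M]

theorem IsCylindricalStructure.add {t : M → ℝ} {T Yp : SmoothField n M}
    (h : IsCylindricalStructure t T) (hp : IsPerpendicular t Yp) :
    IsCylindricalStructure t (T + Yp) := by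
  refine ⟨h.smooth_near_infinity, h.proper, h.bounded_below, eventually_cocompact_iff.1 ?_⟩
  filter_upwards [eventually_cocompact_iff.2 h.deriv_eq_one, eventually_cocompact_iff.2 hp]
    with x h1 h2
  change mvfderiv (𝓡 n) t x (T x + Yp x) = 1
  rw [map_add, h1, h2, add_zero]

theorem IsPerturbation.of_isWeaklyBounded [T2Space M] {t : M → ℝ} {τ : SmoothFun n M}
    {T Yp : SmoothField n M} (hτ : Tendsto τ (cocompact M) atTop)
    (ht : ∀ᶠ x in cocompact M, t x = τ x) (hT : ∀ᶠ x in cocompact M, fieldDeriv T τ x = 1)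
    (hperp : IsPerpendicular t Yp) (hstrong : IsStronglyBounded T (fun x => Yp x))
    (hweak : ∀ X : SmoothField n M, IsConstantField T X →
      IsWeaklyBounded T (fun x => t x • VectorField.mlieBracket (𝓡 n) X Yp x)) :
    IsPerturbation τ T Yp := by
  refine ⟨hτ, hT, ?_, hstrong, fun X hX => ?_⟩
  · filter_upwards [eventually_eventually_nhds_cocompact ht, eventually_cocompact_iff.2 hperp]
      with x h1 h2
    have h3 : t =ᶠ[𝓝 x] τ := h1
    have h4 : mvfderiv (𝓡 n) t x = mvfderiv (𝓡 n) τ x := h3.mfderiv_eq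
    rw [h4] at h2
    exact h2
  · obtain ⟨m, φ, Z, hZ, hφ, hsum⟩ := hweak X hX
    refine ⟨m, φ, Z, hZ, fun i => (hφ i).imp fun B hB => Eventually.of_forall hB, ?_⟩
    filter_upwards [ht] with x hx
    rw [← hx]
    exact hsum x

end Main

end CylEnd

end

theorem mainTheorem6 {n : ℕ} {M : Type*} [TopologicalSpace M] [T2Space M] [NoncompactSpace M]
    [ChartedSpace (CylEnd.Model n) M] [IsManifold (𝓡 n) ∞ M]
    (t : M → ℝ) (T Yperp : CylEnd.SmoothField n M)
    (hcyl : CylEnd.IsCylindricalStructure t T)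
    (hperp : CylEnd.IsPerpendicular t Yperp)
    (hstrong : CylEnd.IsStronglyBounded T Yperp)
    (hweak : ∀ X : CylEnd.SmoothField n M, CylEnd.IsConstantField T X →
      CylEnd.IsWeaklyBounded T
        (fun x => t x • VectorField.mlieBracket (𝓡 n) X Yperp x)) :
    CylEnd.IsCylindricalStructure t (T + Yperp) ∧
      ∀ r : ℕ, CylEnd.polynomialForms t T r = CylEnd.polynomialForms t (T + Yperp) r := by
  have := CylEnd.sigmaCompactSpace_of_isProperMap hcyl.proper
  obtain ⟨τ, hτ, ht, hT⟩ := hcyl.exists_smooth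
  have H := CylEnd.IsPerturbation.of_isWeaklyBounded hτ ht hT hperp hstrong hweak
  obtain ⟨κ, _, f, X, hF⟩ := CylEnd.exists_isInvariantFrame hτ hT
  obtain ⟨κ', _, f', X', hF'⟩ := CylEnd.exists_isInvariantFrame hτ H.deriv_add_eq_one
  exact ⟨hcyl.add hperp, H.polynomialForms_eq ht hF hF'⟩
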